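/- Setting. Let $G=(V,E)$ be a finite directed graph with $n=|V|\ge 1$. In the triggering model every node $v$ independently samples a triggering set $T_v$ of in-neighbours of $v$ from a distribution $D_v$; a seed set $S$ is active at time $0$, an active node stays active, and $v$ becomes active at time $t\ge1$ if $T_v$ contains a node that is active at time $t-1$. Let $\sigma(S)$ be the expected number of eventually active nodes. Let $\mathcal D\subseteq\mathbb R^d_+$ be convex, $h_v:\mathbb R^d_+\to[0,1]$ $(v\in V)$, $c:\mathcal D\to\mathbb R$ convex, $k\ge0$, $\lambda\ge0$, and put $$\mathcal P=\{x\in\mathcal D: c(x)\le k\},\quad g(x)=\sum_{S\subseteq V}\sigma(S)\prod_{u\in S}h_u(x)\prod_{v\notin S}(1-h_v(x)),\quad s(x)=\lambda(k-c(x)),\quad \mathrm{OPT}=\sup_{x\in\mathcal P}(g+s)(x).$$ Assume that $\mathcal P$ is bounded and $\mathrm{OPT}\ge 1$. A reverse reachable (RR) set is the random set of nodes that can reach a uniformly random root $v$ in the live-edge graph with edges $\{(w,u):w\in T_u\}$. For a sequence $\mathcal R=(R_1,\dots,R_\theta)$ of RR sets let $\hat g_{\mathcal R}(x)=\frac n\theta\sum_{j}\bigl(1-\prod_{v\in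 R_j}(1-h_v(x))\bigr)$. Let $L_1\ge0$, $L_2>0$ be such that on $\mathcal P$, in the Euclidean norm, $g+s$ is $L_1$-Lipschitz and $\hat g_{\mathcal R}+s$ is $L_2$-Lipschitz for every nonempty sequence $\mathcal R$ of possible RR sets. $\mathcal N(\mathcal P,r)$ is the least cardinality of a finite $N\subset\mathbb R^d$ such that every $x\in\mathcal P$ is within Euclidean distance $r$ of a point of $N$. An algorithm $\mathcal A$ takes a sequence $\mathcal R$ of RR sets and an additive error $\delta>0$, and returns a point of $\mathcal P$. It has approximation ratio $\alpha$ if, for every $\delta>0$, it is an $(\alpha,\delta)$-approximate gradient algorithm for $\hat g_{\mathcal R}+s$ when run with additive error $\delta$: for every nonempty sequence $\mathcal R$ of possible RR sets its output $\hat x$ satisfies $(\hat g_{\mathcal R}+s)(\hat x)\ge\alpha\,(\hat g_{\mathcal R}+s)(y)-\delta$ for all $y\in\mathcal P$. Algorithm Grad-RIS (parameters $\varepsilon,\ell,\alpha>0$). Put $\varepsilon'=\sqrt2\,\varepsilon/3$ and initially $LB=1$. For $i=1,2,\dots,\lfloor\log_2(n+\lambda k)-1\rfloor$: let $x_i=(n+\lambda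 k)/2^i$ and $$\theta_i=\left\lceil n\left(2+\tfrac23\varepsilon'\right)\frac{\ln\mathcal N(\mathcal P,\frac{\varepsilon/3}{L_2}x_i)+\ell\ln n+\ln2+\ln\log_2(n+\lambda k)}{\varepsilon'^2x_i}\right\rceil;$$ enlarge the current collection of independent RR sets to a sequence $\mathcal R_i$ of $\theta_i$ of them; let $y_i$ be the output of $\mathcal A$ on $\mathcal R_i$ with additive error $\frac\varepsilon3x_i$; if $(\hat g_{\mathcal R_i}+s)(y_i)\ge(1+\varepsilon'+\frac\varepsilon3)x_i$, set $LB=(\hat g_{\mathcal R_i}+s)(y_i)/(1+\varepsilon'+\frac\varepsilon3)$ and leave the loop. Then, with $\alpha'=\alpha-\varepsilon/3$, let $$\theta^{(1)}=\frac{8n\ln(4n^\ell)}{LB\,\alpha'^2\,\varepsilon^2/9},\qquad \theta^{(2)}=\frac{2\alpha' n\ln\bigl(4n^\ell\,\mathcal N(\mathcal P,\frac{\varepsilon/3}{L_1+L_2}LB)\bigr)}{\bigl(\frac\varepsilon3-\frac12\alpha'^2\frac\varepsilon3\bigr)^2LB},$$ generate a sequence $\mathcal R$ of $\lceil\max\{\theta^{(1)},\theta^{(2)}\}\rceil$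 fresh independent RR sets, and output the point that $\mathcal A$ returns on $\mathcal R$ with additive error $\frac\varepsilon3LB$. Theorem. For all $\varepsilon,\ell,\alpha>0$ and every algorithm $\mathcal A$ with approximation ratio $\alpha$, with probability at least $1-1/n^\ell$ Grad-RIS outputs a point $x\in\mathcal P$ with $$(g+s)(x)\ge(\alpha-\varepsilon)\,\mathrm{OPT}.$$ -/

import Mathlib

open MeasureTheory
open scoped ENNReal

noncomputable section

/-- An instance of continuous influence maximization with budget saving (CIM-BS): a social network
with node set `V` under the triggering model, a convex domain of strategy mixes in `ℝ₊^d`, strategy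
activation functions, a convex cost function, a budget and a balance parameter. -/
structure CIMBS (V : Type*) (d : ℕ) where
  /-- the directed social network; `graph.Adj u v` means that `u` can directly influence `v` -/
  graph : Digraph V
  /-- the distribution of the triggering set of each node -/
  trig : V → PMF (Finset V)
  /-- triggering sets consist of in-neighbours -/
  trig_subset : ∀ v, ∀ T ∈ (trig v).support, ∀ u ∈ T, graph.Adj u v
  /-- the domain of strategy mixes -/
  dom : Set (EuclideanSpace ℝ (Fin d))
  dom_convex : Convex ℝ dom
  dom_nonneg : ∀ x ∈ dom, ∀ i, 0 ≤ x i
  /-- strategy activation functions -/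
  h : V → EuclideanSpace ℝ (Fin d) → ℝ
  h_mem : ∀ v x, (∀ i, 0 ≤ x i) → h v x ∈ Set.Icc (0 : ℝ) 1
  /-- cost of a strategy mix -/
  cost : EuclideanSpace ℝ (Fin d) → ℝ
  cost_convex : ConvexOn ℝ dom cost
  /-- the total budget `k` -/
  budget : ℝ
  budget_nonneg : 0 ≤ budget
  /-- the balance parameter `λ` -/
  lam : ℝ
  lam_nonneg : 0 ≤ lam

/-- Nodes active at time `t` when the triggering sets are `T` and the seed set is `S`. -/
def activeAt {V : Type*} [Fintype V] [DecidableEq V] (T : V → Finset V) (S : Finset V) :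
    ℕ → Finset V
  | 0 => S
  | t + 1 => activeAt T S t ∪ Finset.univ.filter fun v => (T v ∩ activeAt T S t).Nonempty

open Classical in
/-- Nodes that are eventually active. -/
def finalActive {V : Type*} [Fintype V] [DecidableEq V] (T : V → Finset V) (S : Finset V) :
    Finset V :=
  Finset.univ.filter fun v => ∃ t, v ∈ activeAt T S t

open Classical in
/-- The nodes that can reach `v` in the live-edge graph with edges `{(w, u) | w ∈ T u}`. -/
def rrSet {V : Type*} [Fintype V] (v : V) (T : V → Finset V) : Finset V :=
  Finset.univ.filter fun u => Relation.ReflTransGen (fun w w' => w ∈ T w') u v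

/-- `f` is `L`-Lipschitz on `P` with respect to the 2-norm. -/
def IsLipschitzOn {d : ℕ} (f : EuclideanSpace ℝ (Fin d) → ℝ) (L : ℝ)
    (P : Set (EuclideanSpace ℝ (Fin d))) : Prop :=
  ∀ x ∈ P, ∀ y ∈ P, |f x - f y| ≤ L * ‖x - y‖

/-- The covering number of `P` at radius `r` (net points need not lie in `P`), as a real number. -/
def covNum {d : ℕ} (P : Set (EuclideanSpace ℝ (Fin d))) (r : ℝ) : ℝ :=
  ((Metric.externalCoveringNumber r.toNNReal P).toNat : ℝ)

namespace CIMBS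

variable {V : Type*} [Fintype V] [DecidableEq V] {d : ℕ} (M : CIMBS V d)

/-- The joint law of the triggering sets: independent, with law `trig v` at node `v`. -/
def trigMeasure : Measure (V → Finset V) :=
  Measure.pi fun v => (M.trig v).toMeasure

instance : IsProbabilityMeasure M.trigMeasure := by
  unfold trigMeasure; infer_instance

/-- Influence spread of a seed set: expected number of eventually active nodes. -/
def spread (S : Finset V) : ℝ :=
  ∫ T, ((finalActive T S).card : ℝ) ∂M.trigMeasure

/-- Influence spread of a strategy mix. -/
def g (x : EuclideanSpace ℝ (Fin d)) : ℝ :=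
  ∑ S : Finset V, M.spread S * (∏ u ∈ S, M.h u x) * ∏ v ∈ Sᶜ, (1 - M.h v x)

/-- The budget-saving part of the objective, `λ (k - c(x))`. -/
def s (x : EuclideanSpace ℝ (Fin d)) : ℝ :=
  M.lam * (M.budget - M.cost x)

/-- The feasible region. -/
def feasible : Set (EuclideanSpace ℝ (Fin d)) :=
  {x | x ∈ M.dom ∧ M.cost x ≤ M.budget}

/-- The optimal value of the budget-balanced influence spread `g + s` on the feasible region. -/
def opt : ℝ :=
  sSup ((fun x => M.g x + M.s x) '' M.feasible)

/-- The law of an RR set whose root is uniformly random: the average over all roots. -/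
def rrLaw : Measure (Finset V) :=
  (Fintype.card V : ℝ≥0∞)⁻¹ • ∑ v : V, M.trigMeasure.map (rrSet v)

instance [Nonempty V] : IsProbabilityMeasure M.rrLaw := by
  constructor
  have hv : ∀ v : V, (M.trigMeasure.map (rrSet v)) Set.univ = 1 := fun v => by
    rw [Measure.map_apply (measurable_of_countable _) MeasurableSet.univ]
    simp
  simp only [rrLaw, Measure.smul_apply, Measure.coe_finsetSum, Finset.sum_apply, hv, smul_eq_mul]
  simp [ENNReal.inv_mul_cancel]

/-- `R` is an RR set that occurs with positive probability. -/
def IsRRSet (R : Finset V) : Prop :=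
  ∃ (v : V) (T : V → Finset V), (∀ u, T u ∈ (M.trig u).support) ∧ R = rrSet v T

/-- The estimate of `g` from a sequence of `θ` RR sets. -/
def gHat {θ : ℕ} (R : Fin θ → Finset V) (x : EuclideanSpace ℝ (Fin d)) : ℝ :=
  (Fintype.card V : ℝ) / θ * ∑ j, (1 - ∏ v ∈ R j, (1 - M.h v x))

/-- The algorithm `A`, taking a sequence of RR sets to a strategy mix, is
`(α, δ)`-approximate for the objectives `ĝ_R + s`: it returns a feasible point whose value is at
least `α` times the maximum of `ĝ_R + s` over the feasible region, minus `δ`. -/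
def IsApproxGradientAlgorithm
    (A : (θ : ℕ) → (Fin θ → Finset V) → EuclideanSpace ℝ (Fin d)) (α δ : ℝ) : Prop :=
  ∀ (θ : ℕ) (R : Fin θ → Finset V), (∀ j, M.IsRRSet (R j)) →
    A θ R ∈ M.feasible ∧
      (0 < θ → ∀ y ∈ M.feasible,
        α * (M.gHat R y + M.s y) - δ ≤ M.gHat R (A θ R) + M.s (A θ R))

/-! ### The meta-algorithm

`A δ` is the gradient algorithm run with additive error parameter `δ`. -/

section algorithm

variable (L₁ L₂ ε ℓ α : ℝ)
  (A : ℝ → (θ : ℕ) → (Fin θ → Finset V) → EuclideanSpace ℝ (Fin d))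

/-- `n + λ k` -/
def total : ℝ := (Fintype.card V : ℝ) + M.lam * M.budget

/-- The number of iterations of the sampling loop. -/
def numIter : ℕ := ⌊Real.logb 2 M.total - 1⌋₊

/-- `ε' = √2 ε / 3` -/
def epsPrime : ℝ := Real.sqrt 2 * ε / 3

/-- The `i`-th guess for the lower bound. -/
def guess (i : ℕ) : ℝ := M.total / 2 ^ i

/-- The number of RR sets used in iteration `i ≥ 1`. -/
def thetaIter (i : ℕ) : ℕ :=
  ⌈(Fintype.card V : ℝ) * (2 + 2 / 3 * epsPrime ε) *
      ((Real.log (covNum M.feasible (ε / 3 / L₂ * M.guess i)) + ℓ * Real.log (Fintype.card V) +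
        Real.log 2 + Real.log (Real.logb 2 M.total)) / (epsPrime ε ^ 2 * M.guess i))⌉₊

/-- The value of `ĝ + s` at the point that `A` finds in iteration `i`, when the RR sets generated
in the sampling loop are `ξ 0, ξ 1, …`; iteration `i` uses the first `thetaIter i` of them. -/
def iterValue (ξ : ℕ → Finset V) (i : ℕ) : ℝ :=
  let R : Fin (M.thetaIter L₂ ε ℓ i) → Finset V := fun j => ξ j
  let y := A (ε * M.guess i / 3) _ R
  M.gHat R y + M.s y

/-- Iteration `i` exists and its test succeeds. -/
def Breaks (ξ : ℕ → Finset V) (i : ℕ) : Prop :=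
  1 ≤ i ∧ i ≤ M.numIter ∧
    (1 + epsPrime ε + ε / 3) * M.guess i ≤ M.iterValue L₂ ε ℓ A ξ i

open Classical in
/-- The lower bound `LB` found by the sampling loop, which stops at the first success. -/
def lowerBound (ξ : ℕ → Finset V) : ℝ :=
  if H : ∃ i, M.Breaks L₂ ε ℓ A ξ i then
    M.iterValue L₂ ε ℓ A ξ (Nat.find H) / (1 + epsPrime ε + ε / 3)
  else 1

/-- `θ⁽¹⁾` for a lower bound `LB`. -/
def theta1 (_M : CIMBS V d) (ε ℓ α LB : ℝ) : ℝ :=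
  8 * (Fintype.card V : ℝ) * Real.log (4 * (Fintype.card V : ℝ) ^ ℓ) /
    (LB * (α - ε / 3) ^ 2 * (ε ^ 2 / 9))

/-- `θ⁽²⁾` for a lower bound `LB`. -/
def theta2 (LB : ℝ) : ℝ :=
  2 * (α - ε / 3) * (Fintype.card V : ℝ) *
      Real.log (4 * (Fintype.card V : ℝ) ^ ℓ * covNum M.feasible (ε / 3 / (L₁ + L₂) * LB)) /
    ((ε / 3 - 1 / 2 * (α - ε / 3) ^ 2 * (ε / 3)) ^ 2 * LB)

/-- The number of RR sets regenerated after the loop. -/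
def thetaFinal (LB : ℝ) : ℕ :=
  ⌈max (M.theta1 ε ℓ α LB) (M.theta2 L₁ L₂ ε ℓ α LB)⌉₊

/-- The output of the meta-algorithm, when `ω.1` is the sequence of RR sets generated in the
sampling loop and `ω.2` the sequence of RR sets generated afresh after it. -/
def gradRIS (ω : (ℕ → Finset V) × (ℕ → Finset V)) : EuclideanSpace ℝ (Fin d) :=
  let LB := M.lowerBound L₂ ε ℓ A ω.1
  A (ε / 3 * LB) (M.thetaFinal L₁ L₂ ε ℓ α LB) fun j => ω.2 j

end algorithm

/-- The law of the randomness of the meta-algorithm: all RR sets are independent. -/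
def sampleLaw : Measure ((ℕ → Finset V) × (ℕ → Finset V)) :=
  (Measure.infinitePi fun _ : ℕ => M.rrLaw).prod (Measure.infinitePi fun _ : ℕ => M.rrLaw)

instance [Nonempty V] : IsProbabilityMeasure M.sampleLaw := by
  unfold sampleLaw; infer_instance

end CIMBS

end

/-! By reachability duality, g(x) is n times the mean probability that a random RR set is hit by
seeds drawn with the probabilities h_v(x) (`g_eq_integral`). So ĝ + s is an unbiased average of
i.i.d. bounded terms plus a deterministic one, and the proof is concentration together with a union
bound over a net.

OPT need not be attained and net points may lie outside the feasible region, while h and the cost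
are not assumed continuous there. Both difficulties disappear on `profiles`, the closure of the
triples (x, h(x), s(x)): it is compact, the objective and every estimate are continuous on it, and
closed inequalities extend to it from feasible points. An external net becomes a net of profiles of
no larger size by projecting onto the closed convex hull of nothing more than the closure of the
feasible region (`exists_profiles_cover`).

Two failures are possible, each of probability at most 1/(2n^ℓ). In the loop, LB > OPT would force
an estimate far above OPT in some iteration (`measureReal_opt_lt_lowerBound_le`). Only LB ≤ OPT is
needed; a small LB merely costs samples. In the final phase, with LB ≤ OPT, write e = ε/3 and a = α
- e (`measureReal_value_lt_le`). The guarantee compares the output with α times the estimate of an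
optimal profile κ₀. Split α = a + e: the a-part is controlled by a lower tail bound at κ₀, and the
e-part is moved to the other side, giving an upper tail bound for the estimate of κ minus e times
that of κ₀. It is applied only to net points κ of value at most (α - 2e)OPT, whose variance is
small; this yields the constants of θ⁽²⁾. -/

noncomputable section

/-! ### Concentration for sums of independent copies -/

section concentration

theorem exp_sub_one_sub_le {x : ℝ} (hx : 0 ≤ x) (hx3 : x < 3) :
    Real.exp x - 1 - x ≤ x ^ 2 / (2 * (1 - x / 3)) := by
  have h1 : HasSum (fun n : ℕ => x ^ n / n.factorial) (Real.exp x) := by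
    rw [Real.exp_eq_exp_ℝ]
    exact NormedSpace.expSeries_div_hasSum_exp x
  have h2 := (hasSum_nat_add_iff' 2).mpr h1
  have h3 : HasSum (fun n : ℕ => x ^ 2 / 2 * (x / 3) ^ n) (x ^ 2 / 2 * (1 - x / 3)⁻¹) :=
    (hasSum_geometric_of_lt_one (by positivity) (by linarith)).mul_left _
  have hle : ∀ n : ℕ, x ^ (n + 2) / ((n + 2).factorial : ℝ) ≤ x ^ 2 / 2 * (x / 3) ^ n := by
    intro n
    have hf : (2 : ℝ) * 3 ^ n ≤ ((n + 2).factorial : ℝ) := by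
      have := Nat.factorial_mul_pow_le_factorial (m := 2) (n := n)
      rw [add_comm 2 n] at this
      exact_mod_cast this
    calc x ^ (n + 2) / ((n + 2).factorial : ℝ) ≤ x ^ (n + 2) / (2 * 3 ^ n) := by gcongr
      _ = x ^ 2 / 2 * (x / 3) ^ n := by rw [div_pow]; field_simp; ring
  have h4 := hasSum_le hle h2 h3
  simp only [Finset.sum_range_succ, Finset.sum_range_zero] at h4
  norm_num at h4
  calc Real.exp x - 1 - x ≤ x ^ 2 / 2 * (1 - x / 3)⁻¹ := by linarith
    _ = _ := by rw [← div_div]; rfl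

theorem exp_neg_sub_one_add_le {x : ℝ} (hx : 0 ≤ x) : Real.exp (-x) - 1 + x ≤ x ^ 2 / 2 := by
  have h := Real.quadratic_le_exp_of_nonneg hx
  have h1 : Real.exp (-x) * Real.exp x = 1 := by rw [← Real.exp_add]; simp
  have h2 : Real.exp (-x) * (1 + x + x ^ 2 / 2) ≤ 1 := by
    exact (mul_le_mul_of_nonneg_left h (Real.exp_pos _).le).trans_eq h1
  have h3 : (0 : ℝ) < 1 + x + x ^ 2 / 2 := by positivity
  have h4 : Real.exp (-x) ≤ 1 - x + x ^ 2 / 2 := by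
    refine le_of_mul_le_mul_right ?_ h3
    -- (1 - x + x²/2)(1 + x + x²/2) = 1 + x⁴/4.
    nlinarith [sq_nonneg (x ^ 2)]
  linarith

theorem exp_mul_le_of_mem_Icc (c : ℝ) {a : ℝ} (h0 : 0 ≤ a) (h1 : a ≤ 1) :
    Real.exp (c * a) ≤ 1 + a * (Real.exp c - 1) := by
  have h := convexOn_exp.2 (Set.mem_univ (0 : ℝ)) (Set.mem_univ c) (sub_nonneg.2 h1) h0
    (by ring)
  simp only [smul_eq_mul, mul_zero, zero_add, Real.exp_zero, mul_one] at h
  rw [mul_comm]; linarith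

variable {X : Type*} [MeasurableSpace X] [MeasurableSingletonClass X] [Finite X]
  (μ : Measure X) [IsProbabilityMeasure μ]

/-- Chord bounds for the two exponentials are multiplied; their cross term is nonpositive because
the exponents have opposite signs. Hence f and g may be arbitrarily dependent, as they are when
evaluated on the same RR set. -/
theorem integral_exp_sub_le {f g : X → ℝ} (hf : ∀ x, f x ∈ Set.Icc (0 : ℝ) 1)
    (hg : ∀ x, g x ∈ Set.Icc (0 : ℝ) 1) {a b : ℝ} (ha : 0 ≤ a) (hb : 0 ≤ b) :
    ∫ x, Real.exp (a * f x - b * g x) ∂μ ≤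
      Real.exp ((∫ x, f x ∂μ) * (Real.exp a - 1) + (∫ x, g x ∂μ) * (Real.exp (-b) - 1)) := by
  have hea : 0 ≤ Real.exp a - 1 := by linarith [Real.one_le_exp ha]
  have heb : Real.exp (-b) - 1 ≤ 0 := by
    have : Real.exp (-b) ≤ 1 := Real.exp_le_one_iff.2 (by linarith)
    linarith
  have hpt : ∀ x, Real.exp (a * f x - b * g x) ≤
      1 + f x * (Real.exp a - 1) + g x * (Real.exp (-b) - 1) := by
    intro x
    have h1 := exp_mul_le_of_mem_Icc a (hf x).1 (hf x).2
    have h2 := exp_mul_le_of_mem_Icc (-b) (hg x).1 (hg x).2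
    have h3 : 0 ≤ f x * (Real.exp a - 1) * (g x * -(Real.exp (-b) - 1)) :=
      mul_nonneg (mul_nonneg (hf x).1 hea) (mul_nonneg (hg x).1 (by linarith))
    calc Real.exp (a * f x - b * g x) = Real.exp (a * f x) * Real.exp (-b * g x) := by
          rw [← Real.exp_add]; ring_nf
      _ ≤ (1 + f x * (Real.exp a - 1)) * (1 + g x * (Real.exp (-b) - 1)) := by
          refine mul_le_mul h1 h2 (Real.exp_pos _).le ?_
          have := mul_nonneg (hf x).1 hea
          linarith
      _ ≤ _ := by nlinarith
  calc ∫ x, Real.exp (a * f x - b * g x) ∂μ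
      ≤ ∫ x, (1 + f x * (Real.exp a - 1) + g x * (Real.exp (-b) - 1)) ∂μ :=
        integral_mono Integrable.of_finite Integrable.of_finite hpt
    _ = (∫ x, f x ∂μ) * (Real.exp a - 1) + (∫ x, g x ∂μ) * (Real.exp (-b) - 1) + 1 := by
        rw [integral_add Integrable.of_finite Integrable.of_finite,
          integral_add Integrable.of_finite Integrable.of_finite, integral_mul_const,
          integral_mul_const]
        simp; ring
    _ ≤ _ := Real.add_one_le_exp _

theorem measureReal_sum_ge_le (θ : ℕ) (w : X → ℝ) (a : ℝ) :
    (Measure.infinitePi fun _ : ℕ => μ).real {ξ | a ≤ ∑ j : Fin θ, w (ξ j)} ≤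
      Real.exp (-a) * (∫ x, Real.exp (w x) ∂μ) ^ θ := by
  have hw : Measurable w := measurable_of_countable w
  have hind : ProbabilityTheory.iIndepFun (fun (i : ℕ) (ξ : ℕ → X) => w (ξ i))
      (Measure.infinitePi fun _ : ℕ => μ) :=
    ProbabilityTheory.iIndepFun_infinitePi (X := fun _ => w) fun _ => hw
  have hmeas : ∀ i : ℕ, Measurable fun ξ : ℕ → X => w (ξ i) := fun i =>
    hw.comp (measurable_pi_apply i)
  have hint : Integrable (fun ξ : ℕ → X => Real.exp (1 * ∑ j : Fin θ, w (ξ j)))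
      (Measure.infinitePi fun _ : ℕ => μ) := by
    have : (fun ξ : ℕ → X => Real.exp (1 * ∑ j : Fin θ, w (ξ j))) =
        (fun R : Fin θ → X => Real.exp (1 * ∑ j, w (R j))) ∘ fun ξ j => ξ j := rfl
    have hm : Measurable fun (ξ : ℕ → X) (j : Fin θ) => ξ j := by fun_prop
    rw [this, ← integrable_map_measure (measurable_of_countable _).aestronglyMeasurable
      hm.aemeasurable]
    have : IsProbabilityMeasure ((Measure.infinitePi fun _ : ℕ => μ).map
      fun (ξ : ℕ → X) (j : Fin θ) => ξ j) := Measure.isProbabilityMeasure_map hm.aemeasurable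
    exact Integrable.of_finite
  have h := ProbabilityTheory.measure_ge_le_exp_mul_mgf a zero_le_one hint
  refine h.trans (le_of_eq ?_)
  rw [show -1 * a = -a by ring]
  congr 1
  have hs : (fun ξ : ℕ → X => ∑ j : Fin θ, w (ξ j)) =
      ∑ j ∈ Finset.range θ, fun ξ : ℕ → X => w (ξ j) := by
    funext ξ
    rw [Finset.sum_apply, Fin.sum_univ_eq_sum_range (fun j => w (ξ j))]
  rw [hs, hind.mgf_sum hmeas]
  rw [Finset.prod_eq_pow_card (b := ∫ x, Real.exp (w x) ∂μ), Finset.card_range]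
  intro j _
  have := (measurePreserving_eval_infinitePi (fun _ : ℕ => μ) j).map_eq
  rw [ProbabilityTheory.mgf]
  conv_rhs => rw [← this]
  rw [integral_map (measurable_pi_apply j).aemeasurable
    (measurable_of_countable _).aestronglyMeasurable]
  simp

/-- A Bernstein inequality for the upper tail of sums of independent copies of `f - b * g`. -/
theorem measureReal_sum_sub_ge_le (θ : ℕ) {f g : X → ℝ} (hf : ∀ x, f x ∈ Set.Icc (0 : ℝ) 1)
    (hg : ∀ x, g x ∈ Set.Icc (0 : ℝ) 1) {b t v : ℝ} (hb : 0 ≤ b) (ht : 0 ≤ t) (hv : 0 < v)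
    (hvar : θ * ((∫ x, f x ∂μ) + b ^ 2 * ∫ x, g x ∂μ) ≤ v) :
    (Measure.infinitePi fun _ : ℕ => μ).real
      {ξ | θ * ((∫ x, f x ∂μ) - b * ∫ x, g x ∂μ) + t ≤ ∑ j : Fin θ, (f (ξ j) - b * g (ξ j))} ≤
      Real.exp (-(t ^ 2 / (2 * (v + t / 3)))) := by
  set F := ∫ x, f x ∂μ
  set G := ∫ x, g x ∂μ
  have hF : 0 ≤ F := integral_nonneg fun x => (hf x).1
  have hG : 0 ≤ G := integral_nonneg fun x => (hg x).1
  have hd : 0 < v + t / 3 := by positivity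
  -- Bernstein's choice of the exponential parameter; it makes 1 - l/3 = v/(v + t/3), hence l < 3.
  set l := t / (v + t / 3) with hl
  have hl0 : 0 ≤ l := by positivity
  have hl3' : 1 - l / 3 = v / (v + t / 3) := by rw [hl]; field_simp; ring
  have hl3 : l < 3 := by
    have : 0 < 1 - l / 3 := by rw [hl3']; positivity
    linarith
  rcases hl0.eq_or_lt with h0 | h0
  · have : t = 0 := by
      rcases div_eq_zero_iff.1 h0.symm with h | h
      · exact h
      · exact absurd h hd.ne'
    rw [this]; simp
  have key := measureReal_sum_ge_le μ θ (fun x => l * f x - l * b * g x)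
    (l * (θ * (F - b * G) + t))
  have hset : {ξ : ℕ → X | θ * (F - b * G) + t ≤ ∑ j : Fin θ, (f (ξ j) - b * g (ξ j))} =
      {ξ | l * (θ * (F - b * G) + t) ≤
        ∑ j : Fin θ, (fun x => l * f x - l * b * g x) (ξ j)} := by
    ext ξ
    have : ∑ j : Fin θ, (fun x => l * f x - l * b * g x) (ξ j) =
        l * ∑ j : Fin θ, (f (ξ j) - b * g (ξ j)) := by
      rw [Finset.mul_sum]; exact Finset.sum_congr rfl fun _ _ => by ring
    simp only [Set.mem_ofPred_eq]
    rw [this, mul_le_mul_iff_right₀ h0]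
  rw [hset]
  refine key.trans ?_
  have hlb : 0 ≤ l * b := mul_nonneg hl0 hb
  have hm := integral_exp_sub_le μ hf hg hl0 hlb
  calc _ ≤ Real.exp (-(l * (θ * (F - b * G) + t))) *
        Real.exp (F * (Real.exp l - 1) + G * (Real.exp (-(l * b)) - 1)) ^ θ := by
        gcongr
    _ = Real.exp (-(l * t) + θ * (F * (Real.exp l - 1 - l) +
        G * (Real.exp (-(l * b)) - 1 + l * b))) := by
        rw [← Real.exp_nat_mul, ← Real.exp_add]; ring_nf
    _ ≤ _ := by
        rw [Real.exp_le_exp]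
        set q := l ^ 2 / (2 * (1 - l / 3)) with hq
        have hp : 0 < 1 - l / 3 := by linarith
        have h1 : Real.exp l - 1 - l ≤ q := exp_sub_one_sub_le hl0 hl3
        have h2 : Real.exp (-(l * b)) - 1 + l * b ≤ b ^ 2 * q := by
          refine (exp_neg_sub_one_add_le hlb).trans ?_
          have : l ^ 2 / 2 ≤ q := by
            rw [hq]; gcongr; linarith
          calc (l * b) ^ 2 / 2 = b ^ 2 * (l ^ 2 / 2) := by ring
            _ ≤ _ := by gcongr
        have hq0 : 0 ≤ q := by positivity
        have h3 : θ * (F * (Real.exp l - 1 - l) + G * (Real.exp (-(l * b)) - 1 + l * b)) ≤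
            v * q := by
          calc _ ≤ θ * (F * q + G * (b ^ 2 * q)) := by gcongr
            _ = θ * (F + b ^ 2 * G) * q := by ring
            _ ≤ _ := by gcongr
        have h4 : -(l * t) + v * q = -(t ^ 2 / (2 * (v + t / 3))) := by
          rw [hq, hl3', hl]; field_simp; ring
        linarith

/-- A Chernoff bound for the lower tail of sums of independent copies of `g`. -/
theorem measureReal_sum_le_le (θ : ℕ) {g : X → ℝ} (hg : ∀ x, g x ∈ Set.Icc (0 : ℝ) 1)
    {t v : ℝ} (ht : 0 ≤ t) (hv : 0 < v) (hvar : θ * ∫ x, g x ∂μ ≤ v) :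
    (Measure.infinitePi fun _ : ℕ => μ).real
      {ξ | ∑ j : Fin θ, g (ξ j) ≤ θ * (∫ x, g x ∂μ) - t} ≤ Real.exp (-(t ^ 2 / (2 * v))) := by
  set G := ∫ x, g x ∂μ
  have hG : 0 ≤ G := integral_nonneg fun x => (hg x).1
  set l := t / v with hl
  have hl0 : 0 ≤ l := by positivity
  have key := measureReal_sum_ge_le μ θ (fun x => 0 * g x - l * g x) (-(l * (θ * G - t)))
  refine (measureReal_mono ?_).trans (key.trans ?_)
  · intro ξ hξ
    have : ∑ j : Fin θ, (fun x => 0 * g x - l * g x) (ξ j) = -(l * ∑ j : Fin θ, g (ξ j)) := by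
      rw [Finset.mul_sum, ← Finset.sum_neg_distrib]
      exact Finset.sum_congr rfl fun _ _ => by ring
    simp only [Set.mem_ofPred_eq] at hξ ⊢
    rw [this]
    exact neg_le_neg (mul_le_mul_of_nonneg_left hξ hl0)
  have hm := integral_exp_sub_le μ hg hg le_rfl hl0
  calc _ ≤ Real.exp (-(-(l * (θ * G - t)))) *
        Real.exp (G * (Real.exp 0 - 1) + G * (Real.exp (-l) - 1)) ^ θ := by
        gcongr
    _ = Real.exp (-(l * t) + θ * G * (Real.exp (-l) - 1 + l)) := by
        rw [← Real.exp_nat_mul, ← Real.exp_add]; simp; ring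
    _ ≤ _ := by
        rw [Real.exp_le_exp]
        have h2 : Real.exp (-l) - 1 + l ≤ l ^ 2 / 2 := exp_neg_sub_one_add_le hl0
        have h3 : θ * G * (Real.exp (-l) - 1 + l) ≤ v * (l ^ 2 / 2) := by
          calc _ ≤ θ * G * (l ^ 2 / 2) := by gcongr
            _ ≤ _ := by gcongr
        have h4 : -(l * t) + v * (l ^ 2 / 2) = -(t ^ 2 / (2 * v)) := by
          rw [hl]; field_simp; ring
        linarith

end concentration

/-! ### Reverse reachability and influence spread -/

section influence

variable {V : Type*}

/-- The probability that `R` is hit when each node `v` is independently a seed with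
probability `q v`. -/
def hitProb (q : V → ℝ) (R : Finset V) : ℝ := 1 - ∏ v ∈ R, (1 - q v)

theorem hitProb_mem {q : V → ℝ} (hq : ∀ v, q v ∈ Set.Icc (0 : ℝ) 1) (R : Finset V) :
    hitProb q R ∈ Set.Icc (0 : ℝ) 1 := by
  have h0 : 0 ≤ ∏ v ∈ R, (1 - q v) := Finset.prod_nonneg fun v _ => by linarith [(hq v).2]
  have h1 : ∏ v ∈ R, (1 - q v) ≤ 1 :=
    Finset.prod_le_one (fun v _ => by linarith [(hq v).2]) fun v _ => by linarith [(hq v).1]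
  constructor <;> simp only [hitProb] <;> linarith

theorem continuous_hitProb (R : Finset V) : Continuous fun q : V → ℝ => hitProb q R := by
  unfold hitProb; fun_prop

variable [Fintype V]

section

variable [DecidableEq V]

theorem mem_finalActive_iff (T : V → Finset V) (S : Finset V) (v : V) :
    v ∈ finalActive T S ↔ ∃ u ∈ rrSet v T, u ∈ S := by
  simp only [finalActive, rrSet, Finset.mem_filter, Finset.mem_univ, true_and]
  constructor
  · rintro ⟨t, ht⟩
    induction t generalizing v with
    | zero => exact ⟨v, .refl, ht⟩
    | succ t ih =>
      simp only [activeAt, Finset.mem_union, Finset.mem_filter, Finset.mem_univ, true_and] at ht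
      rcases ht with ht | ⟨w, hw⟩
      · exact ih v ht
      · obtain ⟨hwT, hwA⟩ := Finset.mem_inter.1 hw
        obtain ⟨u, hu, huS⟩ := ih w hwA
        exact ⟨u, hu.tail hwT, huS⟩
  · rintro ⟨u, hu, huS⟩
    induction hu with
    | refl => exact ⟨0, huS⟩
    | tail _ hbc ih =>
      obtain ⟨t, ht⟩ := ih
      refine ⟨t + 1, ?_⟩
      simp only [activeAt, Finset.mem_union, Finset.mem_filter, Finset.mem_univ, true_and]
      exact Or.inr ⟨_, Finset.mem_inter.2 ⟨hbc, ht⟩⟩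

theorem sum_hit_eq_hitProb (q : V → ℝ) (R : Finset V) :
    ∑ S : Finset V, (if ∃ u ∈ R, u ∈ S then (1 : ℝ) else 0) *
      (∏ u ∈ S, q u) * ∏ v ∈ Sᶜ, (1 - q v) = hitProb q R := by
  have h1 : ∑ S : Finset V, (∏ u ∈ S, q u) * ∏ v ∈ Sᶜ, (1 - q v) = 1 := by
    have := Finset.prod_add q (fun v => 1 - q v) Finset.univ
    simp only [add_sub_cancel, Finset.prod_const_one, Finset.powerset_univ] at this
    simp only [Finset.compl_eq_univ_sdiff]
    exact this.symm
  -- Replacing q by 0 on R kills the seed sets that meet R, so the sum is the probability of missing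
  -- R; factors outside R are q + (1 - q) = 1.
  have h2 : ∑ S : Finset V, (∏ u ∈ S, if u ∈ R then 0 else q u) * ∏ v ∈ Sᶜ, (1 - q v) =
      ∏ v ∈ R, (1 - q v) := by
    have := Finset.prod_add (fun u => if u ∈ R then 0 else q u) (fun v => 1 - q v) Finset.univ
    rw [Finset.powerset_univ] at this
    simp only [Finset.compl_eq_univ_sdiff]
    rw [← this, ← Finset.prod_subset (Finset.subset_univ R)]
    · exact Finset.prod_congr rfl fun v hv => by simp [hv]
    · intro v _ hv; simp [hv]
  rw [hitProb, eq_sub_iff_add_eq, ← h2, ← Finset.sum_add_distrib]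
  refine (Finset.sum_congr rfl fun S _ => ?_).trans h1
  split_ifs with h
  · obtain ⟨u, huR, huS⟩ := h
    rw [Finset.prod_eq_zero (f := fun u => if u ∈ R then 0 else q u) huS (by simp [huR])]
    ring
  · have : ∏ u ∈ S, (if u ∈ R then 0 else q u) = ∏ u ∈ S, q u :=
      Finset.prod_congr rfl fun u hu => if_neg fun hR => h ⟨u, hR, hu⟩
    rw [this]; ring

end

namespace CIMBS

variable {d : ℕ} (M : CIMBS V d)

theorem integral_rrLaw (f : Finset V → ℝ) :
    ∫ R, f R ∂M.rrLaw = (Fintype.card V : ℝ)⁻¹ * ∑ v, ∫ T, f (rrSet v T) ∂M.trigMeasure := by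
  rw [rrLaw, integral_smul_measure, integral_finsetSum_measure]
  · simp only [ENNReal.toReal_inv, ENNReal.toReal_natCast, smul_eq_mul]
    congr 1
    refine Finset.sum_congr rfl fun v _ => ?_
    rw [integral_map (measurable_of_countable _).aemeasurable
      (measurable_of_countable _).aestronglyMeasurable]
  · intro v _
    have : IsProbabilityMeasure (M.trigMeasure.map (rrSet v)) :=
      Measure.isProbabilityMeasure_map (measurable_of_countable _).aemeasurable
    exact Integrable.of_finite

/-- The Lipschitz bounds and the guarantee of the algorithm are available only for possible RR sets,
so all other samples must form a null event. -/
theorem ae_isRRSet : ∀ᵐ R ∂M.rrLaw, M.IsRRSet R := by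
  have hT : ∀ᵐ T ∂M.trigMeasure, ∀ u, T u ∈ (M.trig u).support := by
    rw [ae_all_iff]
    intro u
    have h1 : ∀ᵐ S ∂(M.trig u).toMeasure, S ∈ (M.trig u).support := by
      rw [ae_iff, PMF.toMeasure_apply_eq_zero_iff _ (Set.toFinite _).measurableSet]
      exact Set.disjoint_left.2 fun S hS hS' => hS' hS
    exact (measurePreserving_eval (fun v => (M.trig v).toMeasure) u).quasiMeasurePreserving.ae h1
  have hv : ∀ v, (M.trigMeasure.map (rrSet v)) {R | ¬ M.IsRRSet R} = 0 := by
    intro v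
    rw [Measure.map_apply (measurable_of_countable _) (Set.toFinite _).measurableSet]
    exact measure_mono_null (fun T hT' hsupp => hT' ⟨v, T, hsupp, rfl⟩) hT
  rw [ae_iff, rrLaw]
  simp [hv]

theorem ae_isRRSet_seq [Nonempty V] :
    ∀ᵐ ξ ∂(Measure.infinitePi fun _ : ℕ => M.rrLaw), ∀ j, M.IsRRSet (ξ j) := by
  rw [ae_all_iff]
  intro j
  exact (measurePreserving_eval_infinitePi (fun _ : ℕ => M.rrLaw) j).quasiMeasurePreserving.ae
    M.ae_isRRSet

variable [DecidableEq V]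

/-- The number of active nodes is a sum over v of indicators that the RR set rooted at v meets the
seed set; averaging over the root divides this sum by n. -/
theorem g_eq_integral [Nonempty V] (x : EuclideanSpace ℝ (Fin d)) :
    M.g x = Fintype.card V * ∫ R, hitProb (fun v => M.h v x) R ∂M.rrLaw := by
  have hn : (Fintype.card V : ℝ) ≠ 0 := by exact_mod_cast Fintype.card_ne_zero
  rw [integral_rrLaw, mul_inv_cancel_left₀ hn, ← integral_finsetSum _ fun _ _ => Integrable.of_finite]
  simp only [g, spread, mul_assoc, ← integral_mul_const]
  rw [← integral_finsetSum _ fun _ _ => Integrable.of_finite]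
  refine integral_congr_ae (Filter.Eventually.of_forall fun T => ?_)
  simp only [← sum_hit_eq_hitProb]
  rw [Finset.sum_comm]
  refine Finset.sum_congr rfl fun S _ => ?_
  have : ((finalActive T S).card : ℝ) = ∑ v, if ∃ u ∈ rrSet v T, u ∈ S then (1 : ℝ) else 0 := by
    rw [Finset.sum_boole]
    congr 2
    ext v
    simp [mem_finalActive_iff]
  rw [this, Finset.sum_mul]
  simp only [mul_assoc]

end CIMBS

end influence

/-! ### Projection and covering numbers -/

section covering

/-- The angle at the nearest point v is obtuse, so replacing u by v brings it no farther from any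
point of K. This moves net points into the closure of the feasible region without enlarging the
radius. -/
theorem exists_mem_forall_norm_sub_le {F : Type*} [NormedAddCommGroup F] [InnerProductSpace ℝ F]
    {K : Set F} (hne : K.Nonempty) (hcomp : IsComplete K) (hconv : Convex ℝ K) (u : F) :
    ∃ v ∈ K, ∀ w ∈ K, ‖w - v‖ ≤ ‖w - u‖ := by
  obtain ⟨v, hv, h⟩ := exists_norm_eq_iInf_of_complete_convex hne hcomp hconv u
  refine ⟨v, hv, fun w hw => ?_⟩
  have hi := (norm_eq_iInf_iff_real_inner_le_zero hconv hv).1 h w hw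
  have h1 : ‖w - u‖ ^ 2 = ‖w - v‖ ^ 2 - 2 * inner ℝ (w - v) (u - v) + ‖u - v‖ ^ 2 := by
    rw [← norm_sub_sq_real]; congr 2; abel
  rw [real_inner_comm] at hi
  refine le_of_sq_le_sq ?_ (norm_nonneg _)
  nlinarith [sq_nonneg ‖u - v‖]

variable {d : ℕ}

theorem exists_cover_card_le {P : Set (EuclideanSpace ℝ (Fin d))} (hb : Bornology.IsBounded P)
    {r : ℝ} (hr : 0 < r) :
    ∃ N : Finset (EuclideanSpace ℝ (Fin d)), (N.card : ℝ) ≤ covNum P r ∧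
      ∀ y ∈ P, ∃ p ∈ N, ‖y - p‖ ≤ r := by
  classical
  -- Finiteness matters: `toNat` would send ⊤ to 0 and void the bound.
  have hfin : Metric.externalCoveringNumber r.toNNReal P ≠ ⊤ := by
    obtain ⟨N, -, hN, hcov⟩ := Metric.exists_finite_isCover_of_isCompact_closure
      (ε := r.toNNReal) (by simpa using hr) hb.isCompact_closure
    exact ((hcov.externalCoveringNumber_le_encard).trans_lt hN.encard_lt_top).ne
  obtain ⟨⟨C, hC⟩, hcard⟩ : ∃ C : {C : Set (EuclideanSpace ℝ (Fin d)) //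
      Metric.IsCover r.toNNReal P C}, C.1.encard = Metric.externalCoveringNumber r.toNNReal P := by
    have : Nonempty {C : Set (EuclideanSpace ℝ (Fin d)) // Metric.IsCover r.toNNReal P C} :=
      ⟨⟨P, .rfl⟩⟩
    have := ciInf_mem fun C : {C : Set (EuclideanSpace ℝ (Fin d)) //
      Metric.IsCover r.toNNReal P C} => C.1.encard
    rwa [iInf_subtype] at this
  have hCf : C.Finite := Set.encard_ne_top_iff.1 (hcard ▸ hfin)
  refine ⟨hCf.toFinset, ?_, fun y hy => ?_⟩
  · rw [covNum, ← hcard, hCf.encard_eq_coe_toFinset_card, ENat.toNat_natCast]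
  · have := Metric.isCover_iff_subset_iUnion_closedBall.1 hC hy
    simp only [Set.mem_iUnion, Metric.mem_closedBall, exists_prop] at this
    obtain ⟨p, hp, hyp⟩ := this
    refine ⟨p, by simpa using hp, ?_⟩
    rw [← dist_eq_norm]
    simpa [hr.le] using hyp

theorem one_le_covNum {P : Set (EuclideanSpace ℝ (Fin d))} (hb : Bornology.IsBounded P)
    (hne : P.Nonempty) {r : ℝ} (hr : 0 < r) : 1 ≤ covNum P r := by
  obtain ⟨N, hN, hcov⟩ := exists_cover_card_le hb hr
  obtain ⟨y, hy⟩ := hne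
  obtain ⟨p, hp, -⟩ := hcov y hy
  have : 1 ≤ N.card := Finset.card_pos.2 ⟨p, hp⟩
  exact le_trans (by exact_mod_cast this) hN

end covering

/-! ### The compact space of profiles -/

namespace CIMBS

variable {V : Type*} {d : ℕ} (M : CIMBS V d)

theorem feasible_convex : Convex ℝ M.feasible := M.cost_convex.convex_le M.budget

theorem h_mem_of_feasible {x : EuclideanSpace ℝ (Fin d)} (hx : x ∈ M.feasible) (v : V) :
    M.h v x ∈ Set.Icc (0 : ℝ) 1 := M.h_mem v x (M.dom_nonneg x hx.1)

theorem s_nonneg {x : EuclideanSpace ℝ (Fin d)} (hx : x ∈ M.feasible) : 0 ≤ M.s x :=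
  mul_nonneg M.lam_nonneg (sub_nonneg.2 hx.2)

/-- The data of a strategy mix on which its objective value and all its estimates depend. -/
def profile (x : EuclideanSpace ℝ (Fin d)) : EuclideanSpace ℝ (Fin d) × (V → ℝ) × ℝ :=
  (x, fun v => M.h v x, M.s x)

/-- The closure of the set of profiles of feasible strategy mixes. -/
def profiles : Set (EuclideanSpace ℝ (Fin d) × (V → ℝ) × ℝ) := closure (M.profile '' M.feasible)

theorem profile_mem {x : EuclideanSpace ℝ (Fin d)} (hx : x ∈ M.feasible) :
    M.profile x ∈ M.profiles := subset_closure ⟨x, hx, rfl⟩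

theorem profiles_induction {p : EuclideanSpace ℝ (Fin d) × (V → ℝ) × ℝ → Prop}
    (hp : IsClosed {κ | p κ}) (h : ∀ x ∈ M.feasible, p (M.profile x))
    {κ : EuclideanSpace ℝ (Fin d) × (V → ℝ) × ℝ} (hκ : κ ∈ M.profiles) : p κ :=
  closure_minimal (t := {κ | p κ}) (by rintro _ ⟨x, hx, rfl⟩; exact h x hx) hp hκ

theorem profiles_snd_fst_mem {κ : EuclideanSpace ℝ (Fin d) × (V → ℝ) × ℝ} (hκ : κ ∈ M.profiles)
    (v : V) : κ.2.1 v ∈ Set.Icc (0 : ℝ) 1 :=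
  M.profiles_induction (isClosed_Icc.preimage (by fun_prop :
    Continuous fun κ : EuclideanSpace ℝ (Fin d) × (V → ℝ) × ℝ => κ.2.1 v))
    (fun _ hx => M.h_mem_of_feasible hx v) hκ

theorem profiles_snd_snd_nonneg {κ : EuclideanSpace ℝ (Fin d) × (V → ℝ) × ℝ}
    (hκ : κ ∈ M.profiles) : 0 ≤ κ.2.2 :=
  M.profiles_induction (isClosed_Ici.preimage (by fun_prop :
    Continuous fun κ : EuclideanSpace ℝ (Fin d) × (V → ℝ) × ℝ => κ.2.2))
    (fun _ hx => M.s_nonneg hx) hκ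

variable [Fintype V]

/-- The objective value of a profile. -/
def value (κ : EuclideanSpace ℝ (Fin d) × (V → ℝ) × ℝ) : ℝ :=
  Fintype.card V * (∫ R, hitProb κ.2.1 R ∂M.rrLaw) + κ.2.2

/-- The estimate of the objective value of a profile from a sequence of RR sets. -/
def estimate {θ : ℕ} (R : Fin θ → Finset V) (κ : EuclideanSpace ℝ (Fin d) × (V → ℝ) × ℝ) : ℝ :=
  Fintype.card V / θ * ∑ j, hitProb κ.2.1 (R j) + κ.2.2

theorem continuous_estimate {θ : ℕ} (R : Fin θ → Finset V) :
    Continuous (estimate (d := d) R) := by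
  have := fun R : Finset V => continuous_hitProb R
  unfold estimate
  fun_prop

theorem continuous_value [Nonempty V] : Continuous M.value := by
  have := fun R : Finset V => continuous_hitProb R
  unfold value
  have h : ∀ q : V → ℝ, ∫ R, hitProb q R ∂M.rrLaw = ∑ R, M.rrLaw.real {R} * hitProb q R :=
    fun q => integral_fintype Integrable.of_finite
  simp only [h]
  fun_prop

theorem integral_hitProb_nonneg {κ : EuclideanSpace ℝ (Fin d) × (V → ℝ) × ℝ}
    (hκ : κ ∈ M.profiles) : 0 ≤ ∫ R, hitProb κ.2.1 R ∂M.rrLaw :=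
  integral_nonneg fun R => (hitProb_mem (M.profiles_snd_fst_mem hκ) R).1

theorem value_nonneg {κ : EuclideanSpace ℝ (Fin d) × (V → ℝ) × ℝ} (hκ : κ ∈ M.profiles) :
    0 ≤ M.value κ :=
  add_nonneg (mul_nonneg (Nat.cast_nonneg _) (M.integral_hitProb_nonneg hκ))
    (M.profiles_snd_snd_nonneg hκ)

theorem card_mul_integral_hitProb_le {κ : EuclideanSpace ℝ (Fin d) × (V → ℝ) × ℝ}
    (hκ : κ ∈ M.profiles) : Fintype.card V * (∫ R, hitProb κ.2.1 R ∂M.rrLaw) ≤ M.value κ :=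
  le_add_of_nonneg_right (M.profiles_snd_snd_nonneg hκ)

theorem abs_estimate_sub_le {L : ℝ} {θ : ℕ} {R : Fin θ → Finset V}
    (hLip : IsLipschitzOn (fun x => M.gHat R x + M.s x) L M.feasible)
    {y : EuclideanSpace ℝ (Fin d)} (hy : y ∈ M.feasible)
    {κ : EuclideanSpace ℝ (Fin d) × (V → ℝ) × ℝ} (hκ : κ ∈ M.profiles) :
    |estimate R (M.profile y) - estimate R κ| ≤ L * ‖y - κ.1‖ := by
  have := continuous_estimate (d := d) R
  exact M.profiles_induction (p := fun κ => |estimate R (M.profile y) - estimate R κ| ≤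
    L * ‖y - κ.1‖) (isClosed_le (by fun_prop) (by fun_prop)) (fun x hx => hLip y hy x hx) hκ

variable [DecidableEq V]

theorem le_opt (hopt : 1 ≤ M.opt) {x : EuclideanSpace ℝ (Fin d)} (hx : x ∈ M.feasible) :
    M.g x + M.s x ≤ M.opt := by
  refine le_csSup ?_ ⟨x, hx, rfl⟩
  by_contra h
  -- An unbounded supremum has the default value 0, which `hopt` excludes.
  have : M.opt = 0 := Real.sSup_of_not_bddAbove h
  linarith

theorem feasible_nonempty (hopt : 1 ≤ M.opt) : M.feasible.Nonempty := by
  by_contra h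
  rw [Set.not_nonempty_iff_eq_empty] at h
  have : M.opt = 0 := by rw [opt, h]; simp
  linarith

variable [Nonempty V]

theorem value_profile (x : EuclideanSpace ℝ (Fin d)) : M.value (M.profile x) = M.g x + M.s x := by
  rw [g_eq_integral]; rfl

theorem abs_value_sub_le {L : ℝ} (hLip : IsLipschitzOn (fun x => M.g x + M.s x) L M.feasible)
    {y : EuclideanSpace ℝ (Fin d)} (hy : y ∈ M.feasible)
    {κ : EuclideanSpace ℝ (Fin d) × (V → ℝ) × ℝ} (hκ : κ ∈ M.profiles) :
    |M.value (M.profile y) - M.value κ| ≤ L * ‖y - κ.1‖ := by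
  have := M.continuous_value
  refine M.profiles_induction (p := fun κ => |M.value (M.profile y) - M.value κ| ≤
    L * ‖y - κ.1‖) (isClosed_le (by fun_prop) (by fun_prop)) (fun x hx => ?_) hκ
  rw [value_profile, value_profile]
  exact hLip y hy x hx

theorem value_le_opt (hopt : 1 ≤ M.opt) {κ : EuclideanSpace ℝ (Fin d) × (V → ℝ) × ℝ}
    (hκ : κ ∈ M.profiles) : M.value κ ≤ M.opt :=
  M.profiles_induction (isClosed_le M.continuous_value continuous_const)
    (fun x hx => (M.value_profile x).trans_le (M.le_opt hopt hx)) hκ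

/-- The coordinates are bounded: x by hypothesis, h by [0,1], and s by [0, OPT] because g ≥ 0. -/
theorem isCompact_profiles (hbdd : Bornology.IsBounded M.feasible) (hopt : 1 ≤ M.opt) :
    IsCompact M.profiles := by
  refine Bornology.IsBounded.isCompact_closure ?_
  refine (hbdd.prod ((Bornology.IsBounded.pi fun _ : V => Metric.isBounded_Icc (0 : ℝ) 1).prod
    (Metric.isBounded_Icc (0 : ℝ) M.opt))).subset ?_
  rintro _ ⟨x, hx, rfl⟩
  refine ⟨hx, fun v _ => M.h_mem_of_feasible hx v, M.s_nonneg hx, ?_⟩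
  refine le_trans ?_ (M.value_le_opt hopt (M.profile_mem hx))
  exact le_add_of_nonneg_left
    (mul_nonneg (Nat.cast_nonneg _) (M.integral_hitProb_nonneg (M.profile_mem hx)))

theorem exists_value_eq_opt (hbdd : Bornology.IsBounded M.feasible) (hopt : 1 ≤ M.opt) :
    ∃ κ ∈ M.profiles, M.value κ = M.opt := by
  obtain ⟨x, hx⟩ := M.feasible_nonempty hopt
  obtain ⟨κ, hκ, hmax⟩ := (M.isCompact_profiles hbdd hopt).exists_isMaxOn
    ⟨_, M.profile_mem hx⟩ M.continuous_value.continuousOn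
  refine ⟨κ, hκ, le_antisymm (M.value_le_opt hopt hκ) ?_⟩
  refine csSup_le ⟨_, x, hx, rfl⟩ ?_
  rintro _ ⟨y, hy, rfl⟩
  exact (M.value_profile y).symm.trans_le (hmax (M.profile_mem hy))

/-- A net of profiles that is no larger than an external net of strategy mixes: the latter is
projected to the closure of the feasible region. -/
theorem exists_profiles_cover (hbdd : Bornology.IsBounded M.feasible) (hopt : 1 ≤ M.opt)
    {r : ℝ} (hr : 0 < r) :
    ∃ N : Finset (EuclideanSpace ℝ (Fin d) × (V → ℝ) × ℝ), (∀ κ ∈ N, κ ∈ M.profiles) ∧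
      (N.card : ℝ) ≤ covNum M.feasible r ∧ ∀ y ∈ M.feasible, ∃ κ ∈ N, ‖y - κ.1‖ ≤ r := by
  classical
  obtain ⟨N, hcard, hcov⟩ := exists_cover_card_le hbdd hr
  -- The first coordinates of a compact set form a closed set, so every limit of feasible points
  -- carries at least one profile.
  have hlift : ∀ p ∈ closure M.feasible, ∃ κ ∈ M.profiles, κ.1 = p := by
    have hcl : IsClosed (Prod.fst '' M.profiles) :=
      ((M.isCompact_profiles hbdd hopt).image continuous_fst).isClosed
    exact closure_minimal (fun x hx => ⟨_, M.profile_mem hx, rfl⟩) hcl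
  have hproj : ∀ u : EuclideanSpace ℝ (Fin d), ∃ κ ∈ M.profiles,
      ∀ y ∈ M.feasible, ‖y - κ.1‖ ≤ ‖y - u‖ := by
    intro u
    obtain ⟨p, hp, h⟩ := exists_mem_forall_norm_sub_le (M.feasible_nonempty hopt).closure
      isClosed_closure.isComplete M.feasible_convex.closure u
    obtain ⟨κ, hκ, rfl⟩ := hlift p hp
    exact ⟨κ, hκ, fun y hy => h y (subset_closure hy)⟩
  choose π hπ hdist using hproj
  refine ⟨N.image π, ?_, le_trans (by exact_mod_cast Finset.card_image_le) hcard, ?_⟩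
  · intro κ hκ
    obtain ⟨u, -, rfl⟩ := Finset.mem_image.1 hκ
    exact hπ u
  · intro y hy
    obtain ⟨u, hu, hyu⟩ := hcov y hy
    exact ⟨π u, Finset.mem_image_of_mem _ hu, (hdist u y hy).trans hyu⟩

end CIMBS

/-! ### Tail bounds for estimates and the two sampling guarantees -/

namespace CIMBS

variable {V : Type*} [Fintype V] {d : ℕ} (M : CIMBS V d)

theorem approx_profile_le {α δ : ℝ} {A : (θ : ℕ) → (Fin θ → Finset V) → EuclideanSpace ℝ (Fin d)}
    (hA : M.IsApproxGradientAlgorithm A α δ) {θ : ℕ} (hθ : 0 < θ) {R : Fin θ → Finset V}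
    (hR : ∀ j, M.IsRRSet (R j)) {κ : EuclideanSpace ℝ (Fin d) × (V → ℝ) × ℝ}
    (hκ : κ ∈ M.profiles) :
    α * estimate R κ - δ ≤ estimate R (M.profile (A θ R)) := by
  have := continuous_estimate (d := d) R
  exact M.profiles_induction (p := fun κ => α * estimate R κ - δ ≤
    estimate R (M.profile (A θ R))) (isClosed_le (by fun_prop) (by fun_prop))
    (fun y hy => (hA θ R hR).2 hθ y hy) hκ

variable [Nonempty V]

/-- Upper tail bound for the estimate of a profile, relative to that of a second one. -/
theorem measureReal_estimate_sub_ge_le {θ : ℕ} (hθ : 0 < θ)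
    {κ κ₀ : EuclideanSpace ℝ (Fin d) × (V → ℝ) × ℝ} (hκ : κ ∈ M.profiles)
    (hκ₀ : κ₀ ∈ M.profiles) {a b B : ℝ} (ha : 0 ≤ a) (hb : 0 ≤ b) (hB : 0 < B)
    (hle : M.value κ + b ^ 2 * M.value κ₀ ≤ B) :
    (Measure.infinitePi fun _ : ℕ => M.rrLaw).real
      {ξ | M.value κ - b * M.value κ₀ + a ≤
        estimate (fun j : Fin θ => ξ j) κ - b * estimate (fun j : Fin θ => ξ j) κ₀} ≤
      Real.exp (-(θ * a ^ 2 / (2 * Fintype.card V * (B + a / 3)))) := by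
  have hn : (0 : ℝ) < Fintype.card V := by exact_mod_cast Fintype.card_pos
  have hθ' : (0 : ℝ) < θ := by exact_mod_cast hθ
  have h1 := M.card_mul_integral_hitProb_le hκ
  have h2 := M.card_mul_integral_hitProb_le hκ₀
  have key := measureReal_sum_sub_ge_le M.rrLaw θ
    (f := hitProb κ.2.1) (g := hitProb κ₀.2.1) (hitProb_mem (M.profiles_snd_fst_mem hκ))
    (hitProb_mem (M.profiles_snd_fst_mem hκ₀)) (b := b) (t := θ / Fintype.card V * a)
    (v := θ / Fintype.card V * B) hb (by positivity) (by positivity) (by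
      have : (Fintype.card V : ℝ) * ((∫ R, hitProb κ.2.1 R ∂M.rrLaw) +
          b ^ 2 * ∫ R, hitProb κ₀.2.1 R ∂M.rrLaw) ≤ B := by
        have := mul_le_mul_of_nonneg_left h2 (sq_nonneg b)
        linarith
      calc _ = θ / Fintype.card V * ((Fintype.card V : ℝ) *
            ((∫ R, hitProb κ.2.1 R ∂M.rrLaw) + b ^ 2 * ∫ R, hitProb κ₀.2.1 R ∂M.rrLaw)) := by
            field_simp
        _ ≤ _ := by gcongr)
  refine (measureReal_mono ?_).trans (key.trans_eq ?_)
  · intro ξ hξ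
    simp only [Set.mem_ofPred_eq, value, estimate] at hξ ⊢
    rw [Finset.sum_sub_distrib, ← Finset.mul_sum]
    set F := ∫ R, hitProb κ.2.1 R ∂M.rrLaw
    set G := ∫ R, hitProb κ₀.2.1 R ∂M.rrLaw
    set f := ∑ j : Fin θ, hitProb κ.2.1 (ξ j)
    set g := ∑ j : Fin θ, hitProb κ₀.2.1 (ξ j)
    -- The budget-saving terms are deterministic and cancel.
    have h3 : Fintype.card V * (F - b * G) + a ≤ Fintype.card V / θ * (f - b * g) := by linarith
    have h4 := mul_le_mul_of_nonneg_left h3 (by positivity : (0 : ℝ) ≤ θ / Fintype.card V)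
    calc _ = θ / Fintype.card V * (Fintype.card V * (F - b * G) + a) := by field_simp
      _ ≤ _ := h4
      _ = _ := by field_simp
  · congr 2
    field_simp

/-- Lower tail bound for the estimate of a profile. -/
theorem measureReal_estimate_le_le {θ : ℕ} (hθ : 0 < θ)
    {κ : EuclideanSpace ℝ (Fin d) × (V → ℝ) × ℝ} (hκ : κ ∈ M.profiles) {a B : ℝ} (ha : 0 ≤ a)
    (hB : 0 < B) (hle : M.value κ ≤ B) :
    (Measure.infinitePi fun _ : ℕ => M.rrLaw).real
      {ξ | estimate (fun j : Fin θ => ξ j) κ ≤ M.value κ - a} ≤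
      Real.exp (-(θ * a ^ 2 / (2 * Fintype.card V * B))) := by
  have hn : (0 : ℝ) < Fintype.card V := by exact_mod_cast Fintype.card_pos
  have hθ' : (0 : ℝ) < θ := by exact_mod_cast hθ
  have h1 := M.card_mul_integral_hitProb_le hκ
  have key := measureReal_sum_le_le M.rrLaw θ
    (g := hitProb κ.2.1) (hitProb_mem (M.profiles_snd_fst_mem hκ)) (t := θ / Fintype.card V * a)
    (v := θ / Fintype.card V * B) (by positivity) (by positivity) (by
      calc _ = θ / Fintype.card V * ((Fintype.card V : ℝ) *
            (∫ R, hitProb κ.2.1 R ∂M.rrLaw)) := by field_simp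
        _ ≤ _ := by gcongr; exact h1.trans hle)
  refine (measureReal_mono ?_).trans (key.trans_eq ?_)
  · intro ξ hξ
    simp only [Set.mem_ofPred_eq, value, estimate] at hξ ⊢
    set F := ∫ R, hitProb κ.2.1 R ∂M.rrLaw
    set f := ∑ j : Fin θ, hitProb κ.2.1 (ξ j)
    have h3 : Fintype.card V / θ * f ≤ Fintype.card V * F - a := by linarith
    have h4 := mul_le_mul_of_nonneg_left h3 (by positivity : (0 : ℝ) ≤ θ / Fintype.card V)
    calc f = θ / Fintype.card V * (Fintype.card V / θ * f) := by field_simp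
      _ ≤ _ := h4
      _ = _ := by field_simp
  · congr 2
    field_simp

variable [DecidableEq V]

/-- The approximation ratio of a gradient algorithm is at most `1`. -/
theorem approxRatio_le_one (hbdd : Bornology.IsBounded M.feasible) (hopt : 1 ≤ M.opt) {α : ℝ}
    {A : ℝ → (θ : ℕ) → (Fin θ → Finset V) → EuclideanSpace ℝ (Fin d)}
    (hA : ∀ δ : ℝ, 0 < δ → M.IsApproxGradientAlgorithm (A δ) α δ) : α ≤ 1 := by
  by_contra! hα
  obtain ⟨κ₀, hκ₀, hval⟩ := M.exists_value_eq_opt hbdd hopt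
  -- The estimate from one RR set is unbiased, so some possible S has estimate at least OPT ≥ 1 at
  -- κ₀. Its maximum m is then positive, and α > 1 contradicts the guarantee at additive error (α -
  -- 1)m/2.
  have hint : ∫ S, estimate (fun _ : Fin 1 => S) κ₀ ∂M.rrLaw = M.opt := by
    rw [← hval, value, ← integral_const_mul]
    simp only [estimate]
    rw [integral_add Integrable.of_finite Integrable.of_finite]
    simp
  obtain ⟨S, hS, hle⟩ := exists_notMem_null_integral_le
    (f := fun S => estimate (fun _ : Fin 1 => S) κ₀) (μ := M.rrLaw) Integrable.of_finite
    (ae_iff.1 M.ae_isRRSet)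
  have hRR : ∀ j : Fin 1, M.IsRRSet ((fun _ => S) j) := fun _ => by simpa using hS
  rw [hint] at hle
  obtain ⟨κ, hκ, hmax⟩ := (M.isCompact_profiles hbdd hopt).exists_isMaxOn ⟨κ₀, hκ₀⟩
    (continuous_estimate fun _ : Fin 1 => S).continuousOn
  set m := estimate (fun _ : Fin 1 => S) κ with hm
  have hm1 : 1 ≤ m := hopt.trans (hle.trans (hmax hκ₀))
  have hδ : 0 < (α - 1) * m / 2 := by
    have : 0 < α - 1 := by linarith
    positivity
  have h1 := M.approx_profile_le (hA _ hδ) one_pos hRR hκ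
  have h2 := hmax (M.profile_mem (hA _ hδ 1 _ hRR).1)
  have h3 : estimate (fun _ : Fin 1 => S)
      (M.profile (A ((α - 1) * m / 2) 1 fun _ => S)) ≤ m := h2
  rw [← hm] at h1
  linarith

/-- With enough RR sets it is unlikely that some feasible point has an estimate much larger than
an upper bound `X` of the optimum. -/
theorem measureReal_exists_estimate_ge_le (hbdd : Bornology.IsBounded M.feasible)
    (hopt : 1 ≤ M.opt) {L e e' x X C : ℝ} (hL : 0 < L) (he : 0 < e) (he' : 0 < e')
    (hx : 0 < x) (hxX : x ≤ X) (hX : M.opt ≤ X) {θ : ℕ} (hθ : 0 < θ)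
    (hθle : (Fintype.card V : ℝ) * (2 + 2 / 3 * e') *
      ((Real.log (covNum M.feasible (e / L * x)) + C) / (e' ^ 2 * x)) ≤ θ)
    (hLip : ∀ R : Fin θ → Finset V, (∀ j, M.IsRRSet (R j)) →
      IsLipschitzOn (fun y => M.gHat R y + M.s y) L M.feasible) :
    (Measure.infinitePi fun _ : ℕ => M.rrLaw).real
      {ξ | (∀ j, M.IsRRSet (ξ j)) ∧ ∃ y ∈ M.feasible,
        (1 + e' + e) * X ≤ estimate (fun j : Fin θ => ξ j) (M.profile y)} ≤ Real.exp (-C) := by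
  have hn : (0 : ℝ) < Fintype.card V := by exact_mod_cast Fintype.card_pos
  have hθ' : (0 : ℝ) < θ := by exact_mod_cast hθ
  have hX0 : 0 < X := hx.trans_le hxX
  have hr : 0 < e / L * x := by positivity
  obtain ⟨N, hN, hcard, hcov⟩ := M.exists_profiles_cover hbdd hopt hr
  have hN1 := one_le_covNum hbdd (M.feasible_nonempty hopt) hr
  set Q := covNum M.feasible (e / L * x)
  -- The two-profile bound with b = 0. Deviation e'X and variance proxy X give the factor 2 + 2e'/3;
  -- the remaining eX pays for rounding to the net.
  let E (κ : EuclideanSpace ℝ (Fin d) × (V → ℝ) × ℝ) : Set (ℕ → Finset V) :=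
    {ξ | M.value κ - 0 * M.value κ + e' * X ≤
      estimate (fun j : Fin θ => ξ j) κ - 0 * estimate (fun j : Fin θ => ξ j) κ}
  have hpt : ∀ κ ∈ N, (Measure.infinitePi fun _ : ℕ => M.rrLaw).real (E κ) ≤
      Real.exp (-C) / Q := by
    intro κ hκ
    refine (M.measureReal_estimate_sub_ge_le hθ (hN κ hκ) (hN κ hκ) (by positivity) le_rfl hX0
      ?_).trans ?_
    · simpa using (M.value_le_opt hopt (hN κ hκ)).trans hX
    · rw [← Real.exp_log (show 0 < Q by linarith), ← Real.exp_sub, Real.exp_le_exp]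
      have h1 : Real.log Q + C ≤ θ * e' ^ 2 * x / (Fintype.card V * (2 + 2 / 3 * e')) := by
        rw [le_div_iff₀ (by positivity)]
        calc (Real.log Q + C) * (Fintype.card V * (2 + 2 / 3 * e')) =
            (Fintype.card V * (2 + 2 / 3 * e') * ((Real.log Q + C) / (e' ^ 2 * x))) *
              (e' ^ 2 * x) := by field_simp
          _ ≤ θ * (e' ^ 2 * x) := by gcongr
          _ = _ := by ring
      have h2 : θ * e' ^ 2 * x / (Fintype.card V * (2 + 2 / 3 * e')) ≤
          θ * e' ^ 2 * X / (Fintype.card V * (2 + 2 / 3 * e')) := by gcongr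
      have h3 : θ * (e' * X) ^ 2 / (2 * Fintype.card V * (X + e' * X / 3)) =
          θ * e' ^ 2 * X / (Fintype.card V * (2 + 2 / 3 * e')) := by
        field_simp
      rw [h3]; linarith
  have hunion : (Measure.infinitePi fun _ : ℕ => M.rrLaw).real (⋃ κ ∈ N, E κ) ≤
      Real.exp (-C) := by
    refine (measureReal_biUnion_finset_le _ _).trans ((Finset.sum_le_sum hpt).trans ?_)
    rw [Finset.sum_const, nsmul_eq_mul]
    calc (N.card : ℝ) * (Real.exp (-C) / Q) ≤ Q * (Real.exp (-C) / Q) := by gcongr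
      _ = Real.exp (-C) := by field_simp
  refine (measureReal_mono ?_ (measure_ne_top _ _)).trans hunion
  rintro ξ ⟨hRR, y, hy, hyX⟩
  obtain ⟨κ, hκ, hd⟩ := hcov y hy
  simp only [Set.mem_iUnion, exists_prop]
  refine ⟨κ, hκ, ?_⟩
  change M.value κ - 0 * M.value κ + e' * X ≤
    estimate (fun j : Fin θ => ξ j) κ - 0 * estimate (fun j : Fin θ => ξ j) κ
  have h1 := M.abs_estimate_sub_le (hLip (fun j => ξ j) fun j => hRR j) hy (hN κ hκ)
  have h2 : L * ‖y - κ.1‖ ≤ e * x := by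
    calc L * ‖y - κ.1‖ ≤ L * (e / L * x) := by gcongr
      _ = e * x := by field_simp
  have h3 := (abs_le.1 h1).2
  have h4 := (M.value_le_opt hopt (hN κ hκ)).trans hX
  have h5 : e * x ≤ e * X := by gcongr
  linarith

/-- With enough RR sets the gradient algorithm is unlikely to return a point of small value. -/
theorem measureReal_value_lt_le (hbdd : Bornology.IsBounded M.feasible) (hopt : 1 ≤ M.opt)
    {L₁ L₂ e α c D : ℝ} (hL₁ : 0 ≤ L₁) (hL₂ : 0 < L₂) (he : 0 < e) (hαe : 3 * e < α)
    (hα : α ≤ 1) (hc : 0 < c) (hcopt : c ≤ M.opt) (hD : 1 ≤ D) {θ : ℕ}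
    (hθ : 0 < θ)
    (hθ₁ : 8 * (Fintype.card V : ℝ) * Real.log D / (c * (α - e) ^ 2 * e ^ 2) ≤ θ)
    (hθ₂ : 2 * (α - e) * (Fintype.card V : ℝ) *
      Real.log (D * covNum M.feasible (e / (L₁ + L₂) * c)) /
        ((e - 1 / 2 * (α - e) ^ 2 * e) ^ 2 * c) ≤ θ)
    (hLip₁ : IsLipschitzOn (fun x => M.g x + M.s x) L₁ M.feasible)
    (hLip₂ : ∀ R : Fin θ → Finset V, (∀ j, M.IsRRSet (R j)) →
      IsLipschitzOn (fun y => M.gHat R y + M.s y) L₂ M.feasible)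
    {A : (θ : ℕ) → (Fin θ → Finset V) → EuclideanSpace ℝ (Fin d)}
    (hA : M.IsApproxGradientAlgorithm A α (e * c)) :
    (Measure.infinitePi fun _ : ℕ => M.rrLaw).real
      {ξ | (∀ j : Fin θ, M.IsRRSet (ξ j)) ∧
        M.value (M.profile (A θ fun j => ξ j)) < (α - 3 * e) * M.opt} ≤ 2 / D := by
  have hn : (0 : ℝ) < Fintype.card V := by exact_mod_cast Fintype.card_pos
  have hθ' : (0 : ℝ) < θ := by exact_mod_cast hθ
  have hO : 0 < M.opt := by linarith
  have hL : 0 < L₁ + L₂ := by linarith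
  have hr : 0 < e / (L₁ + L₂) * c := by positivity
  obtain ⟨N, hN, hcard, hcov⟩ := M.exists_profiles_cover hbdd hopt hr
  have hN1 := one_le_covNum hbdd (M.feasible_nonempty hopt) hr
  obtain ⟨κ₀, hκ₀, hval⟩ := M.exists_value_eq_opt hbdd hopt
  set Q := covNum M.feasible (e / (L₁ + L₂) * c)
  set a := α - e with ha
  -- With these values a(1 - e₁) = a - e + e₂: the loss at κ₀ leaves exactly e₂ for the upper tail.
  set e₁ := a * e / 2 with he₁
  set e₂ := e - 1 / 2 * a ^ 2 * e with he₂
  have ha0 : 0 < a := by linarith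
  have ha1 : a < 1 := by linarith
  have he₁0 : 0 < e₁ := by positivity
  have he₂0 : 0 < e₂ := by
    have : a ^ 2 < 1 := by nlinarith
    have : e₂ = e * (1 - a ^ 2 / 2) := by rw [he₂]; ring
    rw [this]
    exact mul_pos he (by linarith)
  have he₂e : e₂ ≤ e := by rw [he₂]; have := mul_nonneg (sq_nonneg a) he.le; linarith
  set O := M.opt
  have hD0 : 0 < D := by linarith
  -- Bounds value κ + e² value κ₀ for the net points that are tested.
  set B := (α - 2 * e + e ^ 2) * O with hB
  have hB0 : 0 < B := mul_pos (by nlinarith) hO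
  let E₁ : Set (ℕ → Finset V) :=
    {ξ | estimate (fun j : Fin θ => ξ j) κ₀ ≤ M.value κ₀ - e₁ * O}
  let E₂ (κ : EuclideanSpace ℝ (Fin d) × (V → ℝ) × ℝ) : Set (ℕ → Finset V) :=
    {ξ | M.value κ - e * M.value κ₀ + e₂ * O ≤
      estimate (fun j : Fin θ => ξ j) κ - e * estimate (fun j : Fin θ => ξ j) κ₀}
  have hE₁ : (Measure.infinitePi fun _ : ℕ => M.rrLaw).real E₁ ≤ 1 / D := by
    refine (M.measureReal_estimate_le_le hθ hκ₀ (by positivity) hO hval.le).trans ?_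
    rw [one_div, ← Real.exp_log (inv_pos.2 hD0), Real.log_inv, Real.exp_le_exp, neg_le_neg_iff]
    have h1 : θ * (e₁ * O) ^ 2 / (2 * Fintype.card V * O) =
        θ * (a ^ 2 * e ^ 2 * O) / (8 * Fintype.card V) := by
      rw [he₁]; field_simp; ring
    rw [h1, le_div_iff₀ (by positivity)]
    rw [div_le_iff₀ (by positivity)] at hθ₁
    calc Real.log D * (8 * Fintype.card V) = 8 * Fintype.card V * Real.log D := by ring
      _ ≤ θ * (c * a ^ 2 * e ^ 2) := hθ₁
      _ = θ * (a ^ 2 * e ^ 2 * c) := by ring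
      _ ≤ _ := by gcongr
  have hE₂ : ∀ κ ∈ N.filter fun κ => M.value κ ≤ (α - 2 * e) * O,
      (Measure.infinitePi fun _ : ℕ => M.rrLaw).real (E₂ κ) ≤ 1 / (D * Q) := by
    intro κ hκ
    obtain ⟨hκN, hκv⟩ := Finset.mem_filter.1 hκ
    refine (M.measureReal_estimate_sub_ge_le hθ (hN κ hκN) hκ₀ (by positivity) he.le hB0
      (by rw [hval, hB]; linarith)).trans ?_
    have hDQ : 0 < D * Q := by positivity
    rw [one_div, ← Real.exp_log (inv_pos.2 hDQ), Real.log_inv, Real.exp_le_exp, neg_le_neg_iff]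
    -- Since 3e < α ≤ 1, both e² and e₂/3 are at most e/3, and they fit in the gap e between α - 2e
    -- and a.
    have hB2 : B + e₂ * O / 3 ≤ a * O := by
      have : α - 2 * e + e ^ 2 + e₂ / 3 ≤ a := by
        have : e ^ 2 ≤ e / 3 := by nlinarith
        linarith
      calc B + e₂ * O / 3 = (α - 2 * e + e ^ 2 + e₂ / 3) * O := by rw [hB]; ring
        _ ≤ _ := by gcongr
    have h1 : θ * (e₂ * O) ^ 2 / (2 * Fintype.card V * (a * O)) ≤
        θ * (e₂ * O) ^ 2 / (2 * Fintype.card V * (B + e₂ * O / 3)) := by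
      gcongr
    refine le_trans ?_ h1
    have h2 : θ * (e₂ * O) ^ 2 / (2 * Fintype.card V * (a * O)) =
        θ * (e₂ ^ 2 * O) / (2 * Fintype.card V * a) := by
      field_simp
    rw [h2, le_div_iff₀ (by positivity)]
    rw [div_le_iff₀ (by positivity)] at hθ₂
    calc Real.log (D * Q) * (2 * Fintype.card V * a) =
        2 * a * Fintype.card V * Real.log (D * Q) := by ring
      _ ≤ θ * (e₂ ^ 2 * c) := hθ₂
      _ ≤ _ := by gcongr
  refine (measureReal_mono (s₂ := E₁ ∪ ⋃ κ ∈ N.filter fun κ => M.value κ ≤ (α - 2 * e) * O,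
    E₂ κ) ?_).trans ((measureReal_union_le _ _).trans ?_)
  · rintro ξ ⟨hRR, hlt⟩
    by_cases hξ : ξ ∈ E₁
    · exact Or.inl hξ
    right
    have hy := (hA θ (fun j => ξ j) hRR).1
    have h0 := M.approx_profile_le hA hθ hRR hκ₀
    set y := A θ fun j => ξ j
    obtain ⟨κ, hκ, hd⟩ := hcov y hy
    have h1 := abs_le.1 (M.abs_estimate_sub_le (hLip₂ (fun j => ξ j) hRR) hy (hN κ hκ))
    have h2 := abs_le.1 (M.abs_value_sub_le hLip₁ hy (hN κ hκ))
    have h3 : L₁ * ‖y - κ.1‖ + L₂ * ‖y - κ.1‖ ≤ e * c := by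
      calc _ = (L₁ + L₂) * ‖y - κ.1‖ := by ring
        _ ≤ (L₁ + L₂) * (e / (L₁ + L₂) * c) := by gcongr
        _ = e * c := by field_simp
    have h4 : 0 ≤ L₂ * ‖y - κ.1‖ := by positivity
    have h5 : e * c ≤ e * O := by gcongr
    simp only [Set.mem_iUnion, exists_prop]
    refine ⟨κ, Finset.mem_filter.2 ⟨hκ, by linarith⟩, ?_⟩
    have h6 : O - e₁ * O < estimate (fun j : Fin θ => ξ j) κ₀ := by
      have : ¬ estimate (fun j : Fin θ => ξ j) κ₀ ≤ M.value κ₀ - e₁ * O := hξ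
      rwa [hval, not_le] at this
    have h7 := mul_lt_mul_of_pos_left h6 ha0
    have h8 : a * (O - e₁ * O) = (a - e + e₂) * O := by rw [he₁, he₂]; ring
    change M.value κ - e * M.value κ₀ + e₂ * O ≤ _
    rw [hval]
    have h9 : α * estimate (fun j : Fin θ => ξ j) κ₀ =
      a * estimate (fun j : Fin θ => ξ j) κ₀ + e * estimate (fun j : Fin θ => ξ j) κ₀ := by
      rw [ha]; ring
    rw [h8] at h7
    have h10 : (a - e + e₂) * O = (α - 2 * e + e₂) * O := by rw [ha]; ring
    -- The slack is 2eO. It absorbs the additive error ec and the two rounding errors, which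
    -- together are at most ec, since c ≤ O.
    linarith
  · have h1 : (Measure.infinitePi fun _ : ℕ => M.rrLaw).real
        (⋃ κ ∈ N.filter fun κ => M.value κ ≤ (α - 2 * e) * O, E₂ κ) ≤ 1 / D := by
      refine (measureReal_biUnion_finset_le _ _).trans ((Finset.sum_le_sum hE₂).trans ?_)
      rw [Finset.sum_const, nsmul_eq_mul]
      have : ((N.filter fun κ => M.value κ ≤ (α - 2 * e) * O).card : ℝ) ≤ Q :=
        le_trans (by exact_mod_cast Finset.card_filter_le _ _) hcard
      calc _ ≤ Q * (1 / (D * Q)) := by gcongr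
        _ = 1 / D := by field_simp
    calc _ ≤ 1 / D + 1 / D := add_le_add hE₁ h1
      _ = 2 / D := by ring

end CIMBS

/-! ### Conditioning on the sampling loop -/

theorem measureReal_prod_le_of_forall {X Y Z : Type*} [MeasurableSpace X] [MeasurableSpace Y]
    [MeasurableSpace Z] [Countable Y] [MeasurableSingletonClass Y] (μ : Measure X) (ν : Measure Z)
    [IsProbabilityMeasure μ] [IsProbabilityMeasure ν] {ρ : X → Y} (hρ : Measurable ρ)
    {B : Y → Set Z} (hB : ∀ y, MeasurableSet (B y)) {p : ℝ} (hp : ∀ y, ν.real (B y) ≤ p) :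
    (μ.prod ν).real {ω | ω.2 ∈ B (ρ ω.1)} ≤ p := by
  have hmeas : MeasurableSet {ω : X × Z | ω.2 ∈ B (ρ ω.1)} := by
    have : {ω : X × Z | ω.2 ∈ B (ρ ω.1)} = ⋃ y, (ρ ⁻¹' {y}) ×ˢ B y := by
      ext ω; simp
    -- Countability of Y gives measurability of the joint event.
    rw [this]
    exact .iUnion fun y => (hρ (measurableSet_singleton y)).prod (hB y)
  have : Nonempty X := nonempty_of_isProbabilityMeasure μ
  have hp0 : 0 ≤ p := measureReal_nonneg.trans (hp (ρ (Classical.arbitrary X)))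
  refine ENNReal.toReal_le_of_le_ofReal hp0 ?_
  rw [Measure.prod_apply hmeas]
  calc ∫⁻ x, ν (Prod.mk x ⁻¹' {ω : X × Z | ω.2 ∈ B (ρ ω.1)}) ∂μ
      ≤ ∫⁻ _, ENNReal.ofReal p ∂μ := by
        refine lintegral_mono fun x => ?_
        exact (ENNReal.le_ofReal_iff_toReal_le (measure_ne_top _ _) hp0).2 (hp (ρ x))
    _ = ENNReal.ofReal p := by simp

/-! ### Failure probabilities of the loop and of the final phase -/

namespace CIMBS

variable {V : Type*} [Fintype V] {d : ℕ} (M : CIMBS V d)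

theorem one_le_total [Nonempty V] : 1 ≤ M.total := by
  have h : (1 : ℝ) ≤ Fintype.card V := by exact_mod_cast Fintype.card_pos
  have := mul_nonneg M.lam_nonneg M.budget_nonneg
  rw [total]; linarith

theorem guess_pos [Nonempty V] (i : ℕ) : 0 < M.guess i :=
  div_pos (by linarith [M.one_le_total]) (by positivity)

theorem epsPrime_pos {ε : ℝ} (hε : 0 < ε) : 0 < epsPrime ε := by
  unfold epsPrime; positivity

theorem thetaIter_pos [Nontrivial V] (hbdd : Bornology.IsBounded M.feasible)
    (hne : M.feasible.Nonempty) {L₂ ε ℓ : ℝ} (hL₂ : 0 < L₂) (hε : 0 < ε) (hℓ : 0 < ℓ) (i : ℕ) :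
    0 < M.thetaIter L₂ ε ℓ i := by
  have hg := M.guess_pos i
  have he := epsPrime_pos hε
  have hn : (2 : ℝ) ≤ Fintype.card V := by exact_mod_cast Fintype.one_lt_card
  have hQ := Real.log_nonneg (one_le_covNum hbdd hne (r := ε / 3 / L₂ * M.guess i)
    (by positivity))
  have htot : 2 ≤ M.total := by
    have := mul_nonneg M.lam_nonneg M.budget_nonneg
    rw [total]; linarith
  have hlog : 0 ≤ Real.log (Real.logb 2 M.total) := by
    refine Real.log_nonneg ?_
    rw [Real.le_logb_iff_rpow_le one_lt_two (by linarith)]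
    simpa using htot
  have hln : 0 < Real.log (Fintype.card V) := Real.log_pos (by linarith)
  have hl2 : 0 < Real.log 2 := Real.log_pos one_lt_two
  refine Nat.ceil_pos.2 ?_
  positivity

variable {L₁ L₂ ε ℓ α : ℝ} {A : ℝ → (θ : ℕ) → (Fin θ → Finset V) → EuclideanSpace ℝ (Fin d)}

theorem lowerBound_pos [Nonempty V] (hε : 0 < ε) (ξ : ℕ → Finset V) :
    0 < M.lowerBound L₂ ε ℓ A ξ := by
  classical
  unfold lowerBound
  split_ifs with H
  · have hb := (Nat.find_spec H).2.2
    have he := epsPrime_pos hε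
    have hden : 0 < 1 + epsPrime ε + ε / 3 := by positivity
    exact div_pos ((mul_pos hden (M.guess_pos _)).trans_le hb) hden
  · exact one_pos

/-- The lower bound only depends on finitely many of the RR sets. -/
theorem lowerBound_congr {ξ ξ' : ℕ → Finset V}
    (h : ∀ i ≤ M.numIter, ∀ j < M.thetaIter L₂ ε ℓ i, ξ j = ξ' j) :
    M.lowerBound L₂ ε ℓ A ξ = M.lowerBound L₂ ε ℓ A ξ' := by
  classical
  have hval : ∀ i ≤ M.numIter, M.iterValue L₂ ε ℓ A ξ i = M.iterValue L₂ ε ℓ A ξ' i := by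
    intro i hi
    have : (fun j : Fin (M.thetaIter L₂ ε ℓ i) => ξ j) =
        fun j : Fin (M.thetaIter L₂ ε ℓ i) => ξ' j :=
      funext fun j => h i hi j j.2
    simp only [iterValue, this]
  have hbr : ∀ i, M.Breaks L₂ ε ℓ A ξ i ↔ M.Breaks L₂ ε ℓ A ξ' i := by
    intro i
    simp only [Breaks]
    refine and_congr_right fun _ => and_congr_right fun hi => ?_
    rw [hval i hi]
  unfold lowerBound
  by_cases H : ∃ i, M.Breaks L₂ ε ℓ A ξ i
  · have H' : ∃ i, M.Breaks L₂ ε ℓ A ξ' i := H.imp fun i => (hbr i).1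
    rw [dif_pos H, dif_pos H', hval _ (Nat.find_spec H).2.1,
      Nat.find_congr' (hp := H) (hq := H') (hbr _)]
  · have H' : ¬ ∃ i, M.Breaks L₂ ε ℓ A ξ' i := fun h => H (h.imp fun i => (hbr i).2)
    rw [dif_neg H, dif_neg H']

theorem thetaFinal_pos [Nonempty V] (hε : 0 < ε) (hℓ : 0 < ℓ) (hα : ε < α) {c : ℝ}
    (hc : 0 < c) : 0 < M.thetaFinal L₁ L₂ ε ℓ α c := by
  have hn : (1 : ℝ) ≤ Fintype.card V := by exact_mod_cast Fintype.card_pos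
  refine Nat.ceil_pos.2 (lt_max_of_lt_left ?_)
  have h1 := Real.one_le_rpow hn hℓ.le
  have hlog : 0 < Real.log (4 * (Fintype.card V : ℝ) ^ ℓ) := Real.log_pos (by linarith)
  have ha : 0 < α - ε / 3 := by linarith
  rw [theta1]
  positivity

variable [DecidableEq V]

/-- The lower bound found by the sampling loop is unlikely to exceed the optimum. -/
theorem measureReal_opt_lt_lowerBound_le [Nontrivial V] (hbdd : Bornology.IsBounded M.feasible)
    (hopt : 1 ≤ M.opt) (hε : 0 < ε) (hℓ : 0 < ℓ) (hL₂ : 0 < L₂)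
    (hLip₂ : ∀ (θ : ℕ) (R : Fin θ → Finset V), 0 < θ → (∀ j, M.IsRRSet (R j)) →
      IsLipschitzOn (fun x => M.gHat R x + M.s x) L₂ M.feasible)
    (hA : ∀ δ : ℝ, 0 < δ → M.IsApproxGradientAlgorithm (A δ) α δ) :
    (Measure.infinitePi fun _ : ℕ => M.rrLaw).real
      {ξ | (∀ j, M.IsRRSet (ξ j)) ∧ M.opt < M.lowerBound L₂ ε ℓ A ξ} ≤
      1 / (2 * (Fintype.card V : ℝ) ^ ℓ) := by
  classical
  have he := epsPrime_pos hε
  have hn : (2 : ℝ) ≤ Fintype.card V := by exact_mod_cast Fintype.one_lt_card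
  have hn0 : (0 : ℝ) < Fintype.card V := by linarith
  have htot : 2 ≤ M.total := by
    have := mul_nonneg M.lam_nonneg M.budget_nonneg
    rw [total]; linarith
  have hlog : 1 ≤ Real.logb 2 M.total := by
    rw [Real.le_logb_iff_rpow_le one_lt_two (by linarith)]
    simpa using htot
  have hden : 0 < 1 + epsPrime ε + ε / 3 := by positivity
  set C := ℓ * Real.log (Fintype.card V) + Real.log 2 + Real.log (Real.logb 2 M.total) with hC
  have hexp : Real.exp (-C) = 1 / (2 * (Fintype.card V : ℝ) ^ ℓ) / Real.logb 2 M.total := by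
    rw [Real.exp_neg, hC, Real.exp_add, Real.exp_add, Real.exp_log two_pos,
      Real.exp_log (by linarith), mul_comm ℓ, ← Real.rpow_def_of_pos hn0]
    field_simp
  -- A successful test with LB > OPT puts the estimate above the threshold for both `guess i` and
  -- OPT. Using the maximum treats guesses on either side of OPT alike.
  let E (i : ℕ) : Set (ℕ → Finset V) := {ξ | (∀ j, M.IsRRSet (ξ j)) ∧ ∃ y ∈ M.feasible,
    (1 + epsPrime ε + ε / 3) * max (M.guess i) M.opt ≤
      estimate (fun j : Fin (M.thetaIter L₂ ε ℓ i) => ξ j) (M.profile y)}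
  have hE : ∀ i ∈ Finset.Icc 1 M.numIter,
      (Measure.infinitePi fun _ : ℕ => M.rrLaw).real (E i) ≤ Real.exp (-C) := by
    intro i _
    have hpos := M.thetaIter_pos hbdd (M.feasible_nonempty hopt) hL₂ hε hℓ i
    refine M.measureReal_exists_estimate_ge_le hbdd hopt hL₂ (by positivity) he (M.guess_pos i)
      (le_max_left _ _) (le_max_right _ _) hpos ?_ fun R hR => hLip₂ _ R hpos hR
    refine le_trans (le_of_eq ?_) (Nat.le_ceil _)
    rw [hC, ← add_assoc, ← add_assoc]
  have hunion : (Measure.infinitePi fun _ : ℕ => M.rrLaw).real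
      (⋃ i ∈ Finset.Icc 1 M.numIter, E i) ≤ 1 / (2 * (Fintype.card V : ℝ) ^ ℓ) := by
    refine (measureReal_biUnion_finset_le _ _).trans ((Finset.sum_le_sum hE).trans ?_)
    rw [Finset.sum_const, nsmul_eq_mul, Nat.card_Icc, hexp, Nat.add_sub_cancel]
    -- The ln log₂(n + λk) term in `thetaIter` pays for the union over iterations.
    have : (M.numIter : ℝ) ≤ Real.logb 2 M.total :=
      (Nat.floor_le (by linarith)).trans (by linarith)
    calc _ ≤ Real.logb 2 M.total *
          (1 / (2 * (Fintype.card V : ℝ) ^ ℓ) / Real.logb 2 M.total) := by gcongr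
      _ = _ := by field_simp
  refine (measureReal_mono ?_ (measure_ne_top _ _)).trans hunion
  rintro ξ ⟨hRR, hlt⟩
  rw [lowerBound] at hlt
  split_ifs at hlt with H
  · obtain ⟨h1, h2, h3⟩ := Nat.find_spec H
    rw [lt_div_iff₀ hden] at hlt
    set i := Nat.find H
    simp only [Set.mem_iUnion, exists_prop]
    refine ⟨i, Finset.mem_Icc.2 ⟨h1, h2⟩, hRR, _,
      (hA (ε * M.guess i / 3) (by have := M.guess_pos i; positivity) (M.thetaIter L₂ ε ℓ i)
        (fun j => ξ j) fun j => hRR j).1, ?_⟩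
    change _ ≤ M.iterValue L₂ ε ℓ A ξ i
    rw [mul_max_of_nonneg _ _ hden.le]
    exact max_le h3 (by linarith)
  · linarith

/-- Given a correct lower bound, the final step is unlikely to fail. -/
theorem measureReal_final_le [Nonempty V] (hbdd : Bornology.IsBounded M.feasible)
    (hopt : 1 ≤ M.opt) (hε : 0 < ε) (hℓ : 0 < ℓ) (hα : ε < α) (hL₁ : 0 ≤ L₁) (hL₂ : 0 < L₂)
    (hLip₁ : IsLipschitzOn (fun x => M.g x + M.s x) L₁ M.feasible)
    (hLip₂ : ∀ (θ : ℕ) (R : Fin θ → Finset V), 0 < θ → (∀ j, M.IsRRSet (R j)) →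
      IsLipschitzOn (fun x => M.gHat R x + M.s x) L₂ M.feasible)
    (hA : ∀ δ : ℝ, 0 < δ → M.IsApproxGradientAlgorithm (A δ) α δ) {c : ℝ} (hc : 0 < c)
    (hcopt : c ≤ M.opt) :
    (Measure.infinitePi fun _ : ℕ => M.rrLaw).real
      {ξ | (∀ j : Fin (M.thetaFinal L₁ L₂ ε ℓ α c), M.IsRRSet (ξ j)) ∧
        M.value (M.profile (A (ε / 3 * c) (M.thetaFinal L₁ L₂ ε ℓ α c) fun j => ξ j)) <
          (α - ε) * M.opt} ≤ 1 / (2 * (Fintype.card V : ℝ) ^ ℓ) := by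
  have hn : (1 : ℝ) ≤ Fintype.card V := by exact_mod_cast Fintype.card_pos
  have hpow := Real.one_le_rpow hn hℓ.le
  have hpos := M.thetaFinal_pos (L₁ := L₁) (L₂ := L₂) hε hℓ hα hc
  have hmax := Nat.le_ceil (max (M.theta1 ε ℓ α c) (M.theta2 L₁ L₂ ε ℓ α c))
  -- D = 4n^ℓ turns the bound 2/D into half of the allowed failure probability.
  have key := M.measureReal_value_lt_le hbdd hopt (e := ε / 3) (α := α) (c := c)
    (D := 4 * (Fintype.card V : ℝ) ^ ℓ) (θ := M.thetaFinal L₁ L₂ ε ℓ α c) hL₁ hL₂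
    (by positivity) (by linarith) (M.approxRatio_le_one hbdd hopt hA) hc hcopt (by linarith) hpos
    (le_trans (le_of_eq (by rw [theta1]; ring_nf)) ((le_max_left _ _).trans hmax))
    ((le_max_right _ _).trans hmax) hLip₁ (fun R hR => hLip₂ _ R hpos hR)
    (hA _ (by positivity))
  rw [mul_div_cancel₀ ε three_ne_zero] at key
  refine key.trans_eq ?_
  field_simp
  norm_num

/-- The event that the lower bound is correct and the final step fails is unlikely. -/
theorem sampleLaw_real_final_le [Nonempty V] (hbdd : Bornology.IsBounded M.feasible)
    (hopt : 1 ≤ M.opt) (hε : 0 < ε) (hℓ : 0 < ℓ) (hα : ε < α) (hL₁ : 0 ≤ L₁) (hL₂ : 0 < L₂)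
    (hLip₁ : IsLipschitzOn (fun x => M.g x + M.s x) L₁ M.feasible)
    (hLip₂ : ∀ (θ : ℕ) (R : Fin θ → Finset V), 0 < θ → (∀ j, M.IsRRSet (R j)) →
      IsLipschitzOn (fun x => M.gHat R x + M.s x) L₂ M.feasible)
    (hA : ∀ δ : ℝ, 0 < δ → M.IsApproxGradientAlgorithm (A δ) α δ) :
    M.sampleLaw.real {ω | M.lowerBound L₂ ε ℓ A ω.1 ≤ M.opt ∧ (∀ j, M.IsRRSet (ω.2 j)) ∧
      M.value (M.profile (M.gradRIS L₁ L₂ ε ℓ α A ω)) < (α - ε) * M.opt} ≤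
      1 / (2 * (Fintype.card V : ℝ) ^ ℓ) := by
  -- LB is read off from the first m RR sets, which take finitely many values. So no measurability
  -- of the algorithm is needed, and the fresh samples can be treated with LB fixed. The padding by
  -- ∅ is never inspected.
  set m := (Finset.range (M.numIter + 1)).sup (M.thetaIter L₂ ε ℓ) with hm
  let ρ (ξ : ℕ → Finset V) : Fin m → Finset V := fun j => ξ j
  let pad (y : Fin m → Finset V) : ℕ → Finset V := fun j => if h : j < m then y ⟨j, h⟩ else ∅
  have hpad : ∀ ξ, M.lowerBound L₂ ε ℓ A (pad (ρ ξ)) = M.lowerBound L₂ ε ℓ A ξ := by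
    intro ξ
    refine M.lowerBound_congr fun i hi j hj => ?_
    have : j < m := hj.trans_le
      (Finset.le_sup (f := M.thetaIter L₂ ε ℓ) (Finset.mem_range.2 (by omega)))
    simp [pad, ρ, this]
  let Bad (c : ℝ) : Set (ℕ → Finset V) :=
    {ξ | (∀ j : Fin (M.thetaFinal L₁ L₂ ε ℓ α c), M.IsRRSet (ξ j)) ∧
        M.value (M.profile (A (ε / 3 * c) (M.thetaFinal L₁ L₂ ε ℓ α c) fun j => ξ j)) <
          (α - ε) * M.opt}
  have hBad : ∀ c, MeasurableSet (Bad c) := fun c => by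
    have hr : Measurable fun (ξ : ℕ → Finset V)
      (j : Fin (M.thetaFinal L₁ L₂ ε ℓ α c)) => ξ j := by fun_prop
    exact hr (Set.toFinite {R : Fin (M.thetaFinal L₁ L₂ ε ℓ α c) → Finset V |
      (∀ j, M.IsRRSet (R j)) ∧ M.value (M.profile (A (ε / 3 * c) _ R)) <
        (α - ε) * M.opt}).measurableSet
  let B (y : Fin m → Finset V) : Set (ℕ → Finset V) :=
    {ξ | M.lowerBound L₂ ε ℓ A (pad y) ≤ M.opt ∧ ξ ∈ Bad (M.lowerBound L₂ ε ℓ A (pad y))}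
  have key := measureReal_prod_le_of_forall (Measure.infinitePi fun _ : ℕ => M.rrLaw)
    (Measure.infinitePi fun _ : ℕ => M.rrLaw) (ρ := ρ) (by fun_prop) (B := B)
    (fun y => (MeasurableSet.const _).inter (hBad _))
    (p := 1 / (2 * (Fintype.card V : ℝ) ^ ℓ)) fun y => by
      by_cases hy : M.lowerBound L₂ ε ℓ A (pad y) ≤ M.opt
      · refine (measureReal_mono (s₂ := Bad _) (fun ξ hξ => hξ.2) (measure_ne_top _ _)).trans
          (M.measureReal_final_le hbdd hopt hε hℓ hα hL₁ hL₂ hLip₁ hLip₂ hA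
            (M.lowerBound_pos hε _) hy)
      · have : B y = ∅ := Set.eq_empty_of_forall_notMem fun ξ hξ => hy hξ.1
        rw [this, measureReal_empty]
        positivity
  refine (measureReal_mono ?_ (measure_ne_top _ _)).trans key
  rintro ω ⟨h1, h2, h3⟩
  change _ ≤ _ ∧ _ ∈ Bad _
  rw [hpad]
  exact ⟨h1, fun j => h2 j, h3⟩

end CIMBS

end

/-! ### Union bound over the failure events -/

theorem theorem1 {V : Type*} [Fintype V] [DecidableEq V] [Nonempty V] {d : ℕ} (M : CIMBS V d)
    (hbdd : Bornology.IsBounded M.feasible) (hopt : 1 ≤ M.opt)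
    (ε ℓ α : ℝ) (hε : 0 < ε) (hℓ : 0 < ℓ) (hα : 0 < α)
    (L₁ L₂ : ℝ) (hL₁ : 0 ≤ L₁) (hL₂ : 0 < L₂)
    (hLip₁ : IsLipschitzOn (fun x => M.g x + M.s x) L₁ M.feasible)
    (hLip₂ : ∀ (θ : ℕ) (R : Fin θ → Finset V), 0 < θ → (∀ j, M.IsRRSet (R j)) →
      IsLipschitzOn (fun x => M.gHat R x + M.s x) L₂ M.feasible)
    (A : ℝ → (θ : ℕ) → (Fin θ → Finset V) → EuclideanSpace ℝ (Fin d))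
    (hA : ∀ δ : ℝ, 0 < δ → M.IsApproxGradientAlgorithm (A δ) α δ) :
    1 - 1 / (Fintype.card V : ℝ) ^ ℓ ≤
      M.sampleLaw.real {ω | M.gradRIS L₁ L₂ ε ℓ α A ω ∈ M.feasible ∧
        (α - ε) * M.opt ≤
          M.g (M.gradRIS L₁ L₂ ε ℓ α A ω) + M.s (M.gradRIS L₁ L₂ ε ℓ α A ω)} := by
  -- For n = 1 the claimed probability is 0. For n ≥ 2 one has log₂(n + λk) ≥ 1, so every
  -- `thetaIter` is positive.
  rcases subsingleton_or_nontrivial V with hV | hV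
  · have : Fintype.card V = 1 :=
      le_antisymm (Fintype.card_le_one_iff_subsingleton.2 hV) Fintype.card_pos
    rw [this]
    simp
  set S := {ω | M.gradRIS L₁ L₂ ε ℓ α A ω ∈ M.feasible ∧
    (α - ε) * M.opt ≤ M.g (M.gradRIS L₁ L₂ ε ℓ α A ω) + M.s (M.gradRIS L₁ L₂ ε ℓ α A ω)} with hS
  have hn0 : (0 : ℝ) < Fintype.card V := by exact_mod_cast Fintype.card_pos
  have hpow : 0 < (Fintype.card V : ℝ) ^ ℓ := Real.rpow_pos_of_pos hn0 ℓ
  set μ := Measure.infinitePi fun _ : ℕ => M.rrLaw with hμ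
  have hnull : μ.real {ξ | ¬ ∀ j, M.IsRRSet (ξ j)} = 0 := by
    rw [measureReal_def, ae_iff.1 M.ae_isRRSet_seq, ENNReal.toReal_zero]
  have hsample : M.sampleLaw = μ.prod μ := rfl
  let T₁ : Set ((ℕ → Finset V) × (ℕ → Finset V)) := {ξ | ¬ ∀ j, M.IsRRSet (ξ j)} ×ˢ Set.univ
  let T₂ : Set ((ℕ → Finset V) × (ℕ → Finset V)) := Set.univ ×ˢ {ξ | ¬ ∀ j, M.IsRRSet (ξ j)}
  let T₃ : Set ((ℕ → Finset V) × (ℕ → Finset V)) :=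
    {ξ | (∀ j, M.IsRRSet (ξ j)) ∧ M.opt < M.lowerBound L₂ ε ℓ A ξ} ×ˢ Set.univ
  let T₄ : Set ((ℕ → Finset V) × (ℕ → Finset V)) :=
    {ω | M.lowerBound L₂ ε ℓ A ω.1 ≤ M.opt ∧ (∀ j, M.IsRRSet (ω.2 j)) ∧
      M.value (M.profile (M.gradRIS L₁ L₂ ε ℓ α A ω)) < (α - ε) * M.opt}
  have hT₁ : M.sampleLaw.real T₁ = 0 := by rw [hsample, measureReal_prod_prod, hnull, zero_mul]
  have hT₂ : M.sampleLaw.real T₂ = 0 := by rw [hsample, measureReal_prod_prod, hnull, mul_zero]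
  have hT₃ : M.sampleLaw.real T₃ ≤ 1 / (2 * (Fintype.card V : ℝ) ^ ℓ) := by
    rw [hsample, measureReal_prod_prod, probReal_univ, mul_one]
    exact M.measureReal_opt_lt_lowerBound_le hbdd hopt hε hℓ hL₂ hLip₂ hA
  have hfeas : ∀ ω : (ℕ → Finset V) × (ℕ → Finset V), (∀ j, M.IsRRSet (ω.2 j)) →
      M.gradRIS L₁ L₂ ε ℓ α A ω ∈ M.feasible := by
    intro ω hω
    have hLB := M.lowerBound_pos (L₂ := L₂) (ℓ := ℓ) (A := A) hε ω.1
    exact (hA (ε / 3 * M.lowerBound L₂ ε ℓ A ω.1) (by positivity) _ (fun j => ω.2 j)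
      fun j => hω j).1
  have hT₄ : M.sampleLaw.real T₄ ≤ 1 / (2 * (Fintype.card V : ℝ) ^ ℓ) := by
    rcases lt_or_ge ε α with hεα | hεα
    · exact M.sampleLaw_real_final_le hbdd hopt hε hℓ hεα hL₁ hL₂ hLip₁ hLip₂ hA
    -- The target (α - ε)OPT is nonpositive here, while feasible points have nonnegative value.
    · have : T₄ = ∅ := by
        refine Set.eq_empty_of_forall_notMem fun ω hω => ?_
        have h1 := M.value_nonneg (M.profile_mem (hfeas ω hω.2.1))
        have h2 : (α - ε) * M.opt ≤ 0 :=
          mul_nonpos_of_nonpos_of_nonneg (by linarith) (by linarith)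
        have h3 := hω.2.2
        linarith
      rw [this, measureReal_empty]
      positivity
  have hcover : (Set.univ : Set ((ℕ → Finset V) × (ℕ → Finset V))) ⊆
      S ∪ (T₁ ∪ (T₂ ∪ (T₃ ∪ T₄))) := by
    intro ω _
    by_cases h1 : ∀ j, M.IsRRSet (ω.1 j)
    swap
    · exact Or.inr (Or.inl ⟨h1, trivial⟩)
    by_cases h2 : ∀ j, M.IsRRSet (ω.2 j)
    swap
    · exact Or.inr (Or.inr (Or.inl ⟨trivial, h2⟩))
    by_cases h3 : M.opt < M.lowerBound L₂ ε ℓ A ω.1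
    · exact Or.inr (Or.inr (Or.inr (Or.inl ⟨⟨h1, h3⟩, trivial⟩)))
    by_cases h4 : M.value (M.profile (M.gradRIS L₁ L₂ ε ℓ α A ω)) < (α - ε) * M.opt
    · exact Or.inr (Or.inr (Or.inr (Or.inr ⟨not_lt.1 h3, h2, h4⟩)))
    · refine Or.inl ⟨hfeas ω h2, ?_⟩
      rw [← M.value_profile]
      exact not_lt.1 h4
  have h1 : (1 : ℝ) ≤ M.sampleLaw.real (S ∪ (T₁ ∪ (T₂ ∪ (T₃ ∪ T₄)))) := by
    rw [← probReal_univ (μ := M.sampleLaw)]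
    exact measureReal_mono hcover (measure_ne_top _ _)
  have h2 := measureReal_union_le (μ := M.sampleLaw) S (T₁ ∪ (T₂ ∪ (T₃ ∪ T₄)))
  have h3 := measureReal_union_le (μ := M.sampleLaw) T₁ (T₂ ∪ (T₃ ∪ T₄))
  have h4 := measureReal_union_le (μ := M.sampleLaw) T₂ (T₃ ∪ T₄)
  have h5 := measureReal_union_le (μ := M.sampleLaw) T₃ T₄
  have h6 : 1 / (2 * (Fintype.card V : ℝ) ^ ℓ) + 1 / (2 * (Fintype.card V : ℝ) ^ ℓ) =
      1 / (Fintype.card V : ℝ) ^ ℓ := by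
    field_simp
    norm_num
  linarith
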